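/- **Setting.** Sequences are indexed by $\mathbb N=\{1,2,\dots\}$. $\mathrm{Ball}(\ell^\infty)$ is the set of complex sequences $z$ with $\|z\|_\infty=\sup_j|z_j|<1$, $\mathrm{Ball}(c_{00})$ is its subset of finitely supported sequences, and $\mathbb D_2^\infty=\ell^2\cap \mathrm{Ball}(\ell^\infty)$ is the Hilbert multidisk. $\mathbb D^N$ is identified with a subset of $\mathrm{Ball}(c_{00})$ by adding zeros. The Agler class $\mathcal A_N$ consists of the analytic functions $f:\mathbb D^N\to\overline{\mathbb D}$ such that $\|f(T)\|\le 1$ for every $N$-tuple $T=(T_1,\dots,T_N)$ of commuting operators with $\|T_j\|<1$ on a Hilbert space, where $f(T)$ is defined by the absolutely convergent power series of $f$. The class $\mathcal A_\infty$ consists of the functions $f:\mathrm{Ball}(c_{00})\to\mathbb C$ whose restriction to $\mathbb D^N$ belongs to $\mathcal A_N$ for every $N$. The value of $f\in\mathcal A_\infty$ at $z\in \mathrm{Ball}(\ell^\infty)$ is $f(z)=\lim_{N\to\infty}f(z_1,\dots,z_N,0,0,\dots)$. A function $K:X\times X\to\mathbb C$ is positive semi-definite if $\sum_{z,w\in Y}a(z)\overline{a(w)}K(z,w)\ge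 0$ for every finite $Y\subset X$ and every $a:Y\to\mathbb C$. **Theorem 1.3.** Let $X\subset \mathrm{Ball}(\ell^\infty)$ be a finite subset and let $f:X\to\overline{\mathbb D}$ be a function. Consider the following conditions. 1. There exists $\tilde f\in\mathcal A_\infty$ with $\tilde f|_X=f$. 2. There exist positive semi-definite functions $K_1,K_2,\dots$ on $X$ such that for all $z,w\in X$ $$1-f(z)\overline{f(w)}=\sum_{j=1}^\infty(1-z_j\overline{w_j})K_j(z,w),$$ and $\sum_{j=1}^\infty K_j(z,z)<\infty$ for all $z\in X$. 3. For every $n$ and every sequence $T=(T_1,T_2,\dots)$ of commuting, contractive (operator norm at most $1$), simultaneously diagonalizable complex $n\times n$ matrices whose joint eigenspaces have dimension at most $1$ and whose set $\sigma(T)$ of joint eigenvalues is contained in $X$, we have $\|f(T)\|\le 1$. Here $f(T)$ is the matrix that acts as the scalar $f(z)$ on the joint eigenspace of $T$ at each $z\in\sigma(T)$. Then (1) and (2) are equivalent, and they imply (3). If $X\subset\mathbb D_2^\infty$, then (3) implies (1) and (2). In particular, (1), (2) and (3) are equivalent when $X\subset\mathbb D_2^\infty$. -/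

import Mathlib

open Filter Topology
open scoped ENNReal ComplexOrder ComplexConjugate

namespace SchurAgler

/-- The open unit polydisk `𝔻^N`. -/
def polydisk (N : ℕ) : Set (Fin N → ℂ) := {z | ∀ i, ‖z i‖ < 1}

/-- The Schur class in `N` variables: analytic functions from `𝔻^N` to the closed unit disk.
Values of `f` off `𝔻^N` are irrelevant. -/
def IsSchur {N : ℕ} (f : (Fin N → ℂ) → ℂ) : Prop :=
  AnalyticOnNhd ℂ f (polydisk N) ∧ ∀ z ∈ polydisk N, ‖f z‖ ≤ 1

/-- The monomial `T₁^{α₁} ⋯ T_N^{α_N}` in a tuple of operators. -/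
def opMonomial {N : ℕ} {H : Type} [NormedAddCommGroup H] [InnerProductSpace ℂ H]
    (T : Fin N → H →L[ℂ] H) (α : Fin N → ℕ) : H →L[ℂ] H :=
  (List.ofFn fun i => T i ^ α i).prod

/-- The Schur-Agler class in `N` variables: the functions `f` of the Schur class such that
`‖f(T)‖ ≤ 1` for all `N`-tuples `T` of commuting strict contractions on a Hilbert space.
Here `f(T) = ∑ c_α T^α`, where `∑ c_α z^α` is the (unique) power series of `f` on `𝔻^N`.
Since sums over an infinite index set are unconditional, both series converge absolutely.
Hilbert spaces in `Type` suffice, since `‖f(T)‖` is determined by the separable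
subspaces that are invariant under `T`. -/
def IsAgler {N : ℕ} (f : (Fin N → ℂ) → ℂ) : Prop :=
  IsSchur f ∧
  ∃ c : (Fin N → ℕ) → ℂ,
    (∀ z ∈ polydisk N, HasSum (fun α : Fin N → ℕ => c α * ∏ i, z i ^ α i) (f z)) ∧
    ∀ (H : Type) [NormedAddCommGroup H] [InnerProductSpace ℂ H] [CompleteSpace H]
      (T : Fin N → H →L[ℂ] H),
      (∀ i, ‖T i‖ < 1) → (∀ i k, Commute (T i) (T k)) →
      ∃ A : H →L[ℂ] H, HasSum (fun α : Fin N → ℕ => c α • opMonomial T α) A ∧ ‖A‖ ≤ 1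

/-- The inclusion of `ℂ^N` into sequences, `(z₁, …, z_N) ↦ (z₁, …, z_N, 0, 0, …)`. -/
def zeroExtend {N : ℕ} (z : Fin N → ℂ) : ℕ → ℂ := fun j => if h : j < N then z ⟨j, h⟩ else 0

/-- The Agler class in infinitely many variables, for functions on the open unit ball of `c₀₀`:
every restriction to a polydisk `𝔻^N` is in the Agler class in `N` variables.
The ball of `c₀₀` is the union of the sets `zeroExtend '' polydisk N`, and values
of `F` off that ball are irrelevant. -/
def IsAglerInfty (F : (ℕ → ℂ) → ℂ) : Prop :=
  ∀ N : ℕ, IsAgler fun z : Fin N → ℂ => F (zeroExtend z)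

/-- The Banach space `ℓ^∞` of bounded complex sequences. -/
abbrev EllInfty : Type := lp (fun _ : ℕ => ℂ) ∞

/-- A function `F` on the open unit ball of `c₀₀` takes the value `v` at `z ∈ ℓ^∞` in the sense of
its canonical extension, `F(z) = lim_N F(z₁, …, z_N, 0, 0, …)`. -/
def HasExtendedValue (F : (ℕ → ℂ) → ℂ) (z : EllInfty) (v : ℂ) : Prop :=
  Tendsto (fun N : ℕ => F (zeroExtend fun i : Fin N => z i)) atTop (𝓝 v)

/-- `f : X → ℂ` is the restriction to `X` of (the extension to the ball of `ℓ^∞` of) a function in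
the Agler class in infinitely many variables. -/
def HasAglerExtension (X : Set EllInfty) (f : X → ℂ) : Prop :=
  ∃ F : (ℕ → ℂ) → ℂ, IsAglerInfty F ∧ ∀ z : X, HasExtendedValue F z (f z)

/-- Positive semi-definite functions on a set. -/
def IsPSD {α : Type} (A : α → α → ℂ) : Prop :=
  ∀ (Y : Finset α) (a : α → ℂ), 0 ≤ ∑ z ∈ Y, ∑ w ∈ Y, a z * conj (a w) * A z w

/-- The existence of an Agler decomposition of `1 - f(z) \bar f(w)` on `X`. -/
def HasAglerDecomposition (X : Set EllInfty) (f : X → ℂ) : Prop :=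
  ∃ K : ℕ → X → X → ℂ, (∀ j, IsPSD (K j)) ∧
    (∀ z w : X, HasSum (fun j => (1 - z.1 j * conj (w.1 j)) * K j z w) (1 - f z * conj (f w))) ∧
    ∀ z : X, Summable fun j => K j z z

/-- The joint eigenspace of a sequence of matrices at a sequence of scalars. -/
def jointEigenspace {n : ℕ} (T : ℕ → Matrix (Fin n) (Fin n) ℂ) (z : ℕ → ℂ) :
    Submodule ℂ (Fin n → ℂ) :=
  ⨅ j, Module.End.eigenspace (Matrix.toLin' (T j)) (z j)

/-- The joint spectrum of a sequence of commuting matrices: the set of joint eigenvalues. -/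
def jointSpectrum {n : ℕ} (T : ℕ → Matrix (Fin n) (Fin n) ℂ) : Set (ℕ → ℂ) :=
  {z | jointEigenspace T z ≠ ⊥}

def SimultaneouslyDiagonalizable {n : ℕ} (T : ℕ → Matrix (Fin n) (Fin n) ℂ) : Prop :=
  ∃ S : Matrix (Fin n) (Fin n) ℂ, IsUnit S ∧ ∀ j, (S⁻¹ * T j * S).IsDiag

/-- `‖A‖ ≤ 1` for the operator norm of a matrix acting on Euclidean space. -/
def IsContraction {n : ℕ} (A : Matrix (Fin n) (Fin n) ℂ) : Prop :=
  ‖Matrix.toEuclideanCLM (n := Fin n) (𝕜 := ℂ) A‖ ≤ 1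

/-- `A = f(T)`, through diagonalization: `A` acts as the scalar `f(z)` on the joint eigenspace of
`T` at `z`. If `T` is simultaneously diagonalizable with joint spectrum in `X`, there is
exactly one such `A`. -/
def IsFunctionOf {n : ℕ} {X : Set EllInfty} (f : X → ℂ) (T : ℕ → Matrix (Fin n) (Fin n) ℂ)
    (A : Matrix (Fin n) (Fin n) ℂ) : Prop :=
  ∀ z : X, ∀ v ∈ jointEigenspace T (fun j => z.1 j), A.mulVec v = f z • v

/-- The matrix von Neumann inequality for `f : X → ℂ`. -/
def SatisfiesMatrixVonNeumann (X : Set EllInfty) (f : X → ℂ) : Prop :=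
  ∀ (n : ℕ) (T : ℕ → Matrix (Fin n) (Fin n) ℂ),
    (∀ i j, Commute (T i) (T j)) → (∀ j, IsContraction (T j)) →
    SimultaneouslyDiagonalizable T →
    (∀ z : ℕ → ℂ, Module.finrank ℂ (jointEigenspace T z) ≤ 1) →
    jointSpectrum T ⊆ (fun x : EllInfty => (x : ℕ → ℂ)) '' X →
    ∃ A : Matrix (Fin n) (Fin n) ℂ, IsFunctionOf f T A ∧ IsContraction A

/-- The Hilbert multidisk `ℓ² ∩ Ball(ℓ^∞)`, as a subset of `ℓ^∞`. -/
def hilbertMultidisk : Set EllInfty :=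
  {z | z ∈ Metric.ball (0 : EllInfty) 1 ∧ Summable fun j => ‖z j‖ ^ 2}

end SchurAgler

/-!
Everything is about the cone of kernels `M(z,w) = P(z,w) + ∑ⱼ (1 - zⱼ conj wⱼ) Kⱼ(z,w)` with positive
semi-definite `P` and `Kⱼ`. The defect `P` can be absorbed into `K₀` through the Szegő kernel, but it
is needed for limits, since mass of `∑ⱼ Kⱼ` may escape to `j = ∞`. On square-summable points the
series `∑ⱼ zⱼ conj wⱼ Kⱼ(z,w)` converges uniformly, so the cone is stable under ultralimits
(`HasDefectDecomposition.of_tendsto`). On a finite set it is therefore closed, and the Hahn-Banach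
theorem describes it by duality: the dual cone consists of the Gram matrices of bases on which the
tuple with joint eigenvalues `zⱼ` acts by contractions, up to adding a small multiple of the identity
(`hasDefectDecomposition_of_forall_basis`).

* A decomposition implies the matrix von Neumann inequality by the Schur product theorem.
* In the Hilbert multidisk the converse is the duality just described.
* If `f` extends to `F` in the Agler class, then duality yields a decomposition of
  `1 - F(p) conj F(q)` on the finite sets of truncations `p = (z₁, …, z_m, 0, …)` of length at most
  `n`, and an ultralimit in `n` yields one for all truncations at once. The Gram vectors of its
  kernels at `(z₁, …, z_m, 0, …)`, and their products with the coordinates, have weak limits as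
  `m → ∞`. Taking the limit in one truncation index at a time preserves the identity between inner
  products, which gives a decomposition on `X` (`HasAglerExtension.hasAglerDecomposition`).
* Conversely, a decomposition on `X` says that two families of vectors in `ℓ²` have the same Gram
  matrix. A contraction `V` that maps one to the other (`exists_contraction_of_inner_eq`) defines the
  transfer function `F(x) = ⟨(1 - V Δ(x))⁻¹ V e, e⟩` with the diagonal operator `Δ(x)`. On `𝔻^N` it
  is the transfer function of a finite matrix. The coefficients of its power series are bounded by
  an orthogonality argument (`sum_realizationCoeff_le`), so that commuting strict contractions can
  be substituted, and contractivity of `V` gives `‖F(T)‖ ≤ 1` (`isAgler_of_realization`).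
-/

namespace SchurAgler

variable {α β : Type}

/-! ### Positive semi-definite functions -/

theorem IsPSD.isHermitian {A : α → α → ℂ} (hA : IsPSD A) (z w : α) : conj (A w z) = A z w := by
  classical
  have hdiag (z : α) : (A z z).im = 0 := by
    have h := hA {z} (fun _ => 1)
    simp only [Finset.sum_singleton, map_one, one_mul] at h
    exact (Complex.le_def.1 h).2.symm
  by_cases hzw : z = w
  · subst hzw
    exact Complex.conj_eq_iff_im.2 (hdiag z)
  have h1 := hA {z, w} (fun _ => 1)
  have h2 := hA {z, w} (fun p => if p = z then 1 else Complex.I)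
  simp only [Finset.sum_pair hzw, if_true, if_neg (Ne.symm hzw)] at h1 h2
  have e1 := (Complex.le_def.1 h1).2
  have e2 := (Complex.le_def.1 h2).2
  have := hdiag z
  have := hdiag w
  apply Complex.ext
  · simp at e1 e2 ⊢
    linarith
  · simp at e1 e2 ⊢
    linarith

/-- Positive semi-definiteness agrees with Mathlib's notion for matrices with an arbitrary index
type; the two quadratic forms differ by conjugation of the vector. -/
theorem isPSD_iff {A : α → α → ℂ} : IsPSD A ↔ (Matrix.of A).PosSemidef := by
  classical
  constructor
  · intro hA
    refine ⟨Matrix.ext fun z w => ?_, fun x => ?_⟩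
    · simpa [Matrix.conjTranspose_apply] using hA.isHermitian z w
    · refine (hA x.support fun z => conj (x z)).trans_eq ?_
      simp only [Finsupp.sum, Matrix.of_apply, RCLike.star_def, Complex.conj_conj]
      exact Finset.sum_congr rfl fun _ _ => Finset.sum_congr rfl fun _ _ => by ring
  · intro hA Y a
    have h := hA.2 (Finsupp.onFinset Y (fun z => if z ∈ Y then conj (a z) else 0)
      (fun z hz => by by_contra h; simp [h] at hz))
    refine h.trans_eq ?_
    rw [Finsupp.onFinset_sum _ (by simp)]
    refine Finset.sum_congr rfl fun z hz => ?_
    rw [Finsupp.onFinset_sum _ (by simp)]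
    refine Finset.sum_congr rfl fun w hw => ?_
    simp [hz, hw]
    ring

theorem IsPSD.comp {A : α → α → ℂ} (hA : IsPSD A) (φ : β → α) :
    IsPSD fun z w => A (φ z) (φ w) :=
  isPSD_iff.2 ((isPSD_iff.1 hA).submatrix φ)

theorem IsPSD.mul {A B : α → α → ℂ} (hA : IsPSD A) (hB : IsPSD B) :
    IsPSD fun z w => A z w * B z w :=
  isPSD_iff.2 ((isPSD_iff.1 hA).hadamard (isPSD_iff.1 hB))

theorem IsPSD.add {A B : α → α → ℂ} (hA : IsPSD A) (hB : IsPSD B) :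
    IsPSD fun z w => A z w + B z w :=
  isPSD_iff.2 ((isPSD_iff.1 hA).add (isPSD_iff.1 hB))

theorem isPSD_zero : IsPSD fun _ _ : α => (0 : ℂ) := fun _ _ => by simp

theorem IsPSD.const_mul {A : α → α → ℂ} (hA : IsPSD A) {t : ℝ} (ht : 0 ≤ t) :
    IsPSD fun z w => (t : ℂ) * A z w := by
  intro Y a
  have h := mul_nonneg (Complex.zero_le_real.2 ht) (hA Y a)
  refine h.trans_eq ?_
  simp only [Finset.mul_sum]
  exact Finset.sum_congr rfl fun _ _ => Finset.sum_congr rfl fun _ _ => by ring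

theorem isPSD_inner {H : Type*} [NormedAddCommGroup H] [InnerProductSpace ℂ H] (k : α → H) :
    IsPSD fun z w => inner ℂ (k w) (k z) := by
  intro Y a
  have : ∑ z ∈ Y, ∑ w ∈ Y, a z * conj (a w) * inner ℂ (k w) (k z) =
      inner ℂ (∑ w ∈ Y, a w • k w) (∑ z ∈ Y, a z • k z) := by
    simp only [inner_sum, sum_inner, inner_smul_left, inner_smul_right, mul_assoc, Finset.mul_sum]
  rw [this]
  rw [inner_self_eq_norm_sq_to_K]
  simp

theorem isPSD_rankOne (b : α → ℂ) : IsPSD fun z w => b z * conj (b w) := by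
  simpa [mul_comm] using isPSD_inner b

theorem IsPSD.of_tendsto {I : Type*} {l : Filter I} [l.NeBot] {A : I → α → α → ℂ} {B : α → α → ℂ}
    (hA : ∀ᶠ n in l, IsPSD (A n)) (h : ∀ z w, Tendsto (fun n => A n z w) l (𝓝 (B z w))) :
    IsPSD B := by
  intro Y a
  refine ge_of_tendsto (tendsto_finsetSum _ fun z _ => tendsto_finsetSum _ fun w _ =>
    (h z w).const_mul (a z * conj (a w))) ?_
  filter_upwards [hA] with n hn using hn Y a

theorem isPSD_sum {ι : Type*} {A : ι → α → α → ℂ} (hA : ∀ i, IsPSD (A i)) (s : Finset ι) :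
    IsPSD fun z w => ∑ i ∈ s, A i z w := by
  classical
  induction s using Finset.induction_on with
  | empty => simpa using isPSD_zero
  | insert i s hi ih => simpa [Finset.sum_insert hi] using (hA i).add ih

theorem IsPSD.of_hasSum {ι : Type*} {A : ι → α → α → ℂ} {B : α → α → ℂ} (hA : ∀ i, IsPSD (A i))
    (h : ∀ z w, HasSum (fun i => A i z w) (B z w)) : IsPSD B :=
  IsPSD.of_tendsto (Eventually.of_forall fun s => isPSD_sum hA s) h

theorem IsPSD.diag_nonneg {A : α → α → ℂ} (hA : IsPSD A) (z : α) : 0 ≤ A z z := by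
  simpa using hA {z} (fun _ => 1)

theorem IsPSD.diag_re_nonneg {A : α → α → ℂ} (hA : IsPSD A) (z : α) : 0 ≤ (A z z).re :=
  (Complex.le_def.1 (hA.diag_nonneg z)).1

theorem IsPSD.diag_eq_re {A : α → α → ℂ} (hA : IsPSD A) (z : α) : A z z = ((A z z).re : ℂ) := by
  have h := (Complex.le_def.1 (hA.diag_nonneg z)).2
  exact Complex.ext rfl (by simpa using h.symm)

/-- Every positive semi-definite function is the Gram kernel of a family of vectors in a
Hilbert space, namely of the kernel functions in its reproducing kernel Hilbert space. -/
theorem IsPSD.exists_inner {A : α → α → ℂ} (hA : IsPSD A) :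
    ∃ (H : Type) (_ : NormedAddCommGroup H) (_ : InnerProductSpace ℂ H) (_ : CompleteSpace H)
      (k : α → H), ∀ z w, A z w = inner ℂ (k w) (k z) := by
  classical
  let K : Matrix α α (ℂ →L[ℂ] ℂ) := Matrix.of fun z w => A w z • ContinuousLinearMap.id ℂ ℂ
  have hA' : IsPSD fun z w => A w z := isPSD_iff.2 (isPSD_iff.1 hA).transpose
  have hK : K.PosSemidef := by
    refine ((RKHS.posSemidef_tfae (K := K)).out 0 2 rfl rfl).2 ⟨Matrix.ext fun z w => ?_, fun v : α →₀ ℂ => ?_⟩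
    · rw [Matrix.conjTranspose_apply]
      simp only [K, Matrix.of_apply, star_smul]
      rw [← hA.isHermitian w z]
      congr 1
      exact ContinuousLinearMap.adjoint_id
    · have h := (Complex.le_def.1 (hA' v.support fun z => conj (v z))).1
      refine h.trans_eq ?_
      simp only [Finsupp.sum, K, Matrix.of_apply]
      refine congrArg Complex.re ?_
      refine Finset.sum_congr rfl fun z _ => ?_
      refine Finset.sum_congr rfl fun w _ => ?_
      simp only [RCLike.inner_apply', smul_apply, ContinuousLinearMap.id_apply, smul_eq_mul,
        map_mul, Complex.conj_conj, hA.isHermitian]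
      ring
  have : Fact K.PosSemidef := ⟨hK⟩
  refine ⟨RKHS.OfKernel K, inferInstance, inferInstance, inferInstance,
    fun z => RKHS.kerFun (RKHS.OfKernel K) z 1, fun z w => ?_⟩
  rw [RKHS.kerFun_inner, RKHS.kerFun_apply, RKHS.OfKernel.kernel_ofKernel]
  simp [K]

theorem IsPSD.norm_le {A : α → α → ℂ} (hA : IsPSD A) (z w : α) :
    ‖A z w‖ ≤ ((A z z).re + (A w w).re) / 2 := by
  obtain ⟨H, _, _, _, k, hk⟩ := hA.exists_inner
  have h (p : α) : (A p p).re = ‖k p‖ ^ 2 := by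
    rw [hk, inner_self_eq_norm_sq_to_K]
    norm_cast
  rw [h, h, hk]
  have := norm_inner_le_norm (𝕜 := ℂ) (k w) (k z)
  nlinarith [sq_nonneg (‖k w‖ - ‖k z‖)]

/-- On a finite set, a positive semi-definite function is a finite sum of rank-one ones. -/
theorem IsPSD.exists_sum_rankOne [Fintype α] {A : α → α → ℂ} (hA : IsPSD A) :
    ∃ b : α → α → ℂ, ∀ z w, A z w = ∑ i, b i z * conj (b i w) := by
  classical
  open scoped MatrixOrder in
  obtain ⟨B, hB⟩ := CStarAlgebra.nonneg_iff_eq_star_mul_self.mp (isPSD_iff.1 hA).nonneg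
  refine ⟨fun i z => conj (B i z), fun z w => ?_⟩
  have := congrFun (congrFun hB z) w
  simpa [Matrix.mul_apply, Matrix.star_eq_conjTranspose] using this

/-- Multiplication by the Szegő kernel `1 / (1 - x(z) conj (x(w)))` preserves positivity. -/
theorem IsPSD.szego_mul {P : α → α → ℂ} (hP : IsPSD P) {x : α → ℂ} (hx : ∀ z, ‖x z‖ < 1) :
    IsPSD fun z w => (1 - x z * conj (x w))⁻¹ * P z w := by
  have hn (n : ℕ) : IsPSD fun z w => (x z * conj (x w)) ^ n * P z w := by
    have h := (isPSD_rankOne fun z => x z ^ n).mul hP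
    simpa only [mul_pow, map_pow] using h
  have hs (z w : α) : HasSum (fun n : ℕ => (x z * conj (x w)) ^ n * P z w)
      ((1 - x z * conj (x w))⁻¹ * P z w) := by
    have hlt : ‖x z * conj (x w)‖ < 1 := by
      rw [norm_mul, RCLike.norm_conj]
      exact mul_lt_one_of_nonneg_of_lt_one_left (norm_nonneg _) (hx z) (hx w).le
    exact HasSum.mul_right (P z w) (hasSum_geometric_of_norm_lt_one hlt)
  exact IsPSD.of_hasSum hn hs

/-! ### Decompositions with a defect and their limits -/

/-- `M = P + ∑ⱼ (1 - xⱼ xⱼ*) Kⱼ` on `α` with positive semi-definite `P` and `Kⱼ`, where `xⱼ` is the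
`j`-th coordinate function. The defect `P` plays the role of one more coordinate that vanishes
identically; it makes these decompositions stable under limits in which part of the mass of `(Kⱼ)`
escapes to `j = ∞`. -/
def HasDefectDecomposition (x : ℕ → α → ℂ) (M : α → α → ℂ) : Prop :=
  ∃ (K : ℕ → α → α → ℂ) (P : α → α → ℂ), (∀ j, IsPSD (K j)) ∧ IsPSD P ∧
    (∀ z, Summable fun j => K j z z) ∧
    ∀ z w, HasSum (fun j => (1 - x j z * conj (x j w)) * K j z w) (M z w - P z w)

theorem summable_norm_of_diag {K : ℕ → α → α → ℂ} (hK : ∀ j, IsPSD (K j))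
    (hs : ∀ z, Summable fun j => K j z z) (z w : α) : Summable fun j => ‖K j z w‖ :=
  Summable.of_nonneg_of_le (fun _ => norm_nonneg _) (fun j => (hK j).norm_le z w)
    (((Complex.reCLM.summable (hs z)).add (Complex.reCLM.summable (hs w))).div_const 2)

theorem summable_mul_conj {a b : ℕ → ℂ} (ha : Summable fun j => ‖a j‖ ^ 2)
    (hb : Summable fun j => ‖b j‖ ^ 2) : Summable fun j => ‖a j‖ * ‖b j‖ :=
  Summable.of_nonneg_of_le (fun _ => by positivity)
    (fun j => by nlinarith [sq_nonneg (‖a j‖ - ‖b j‖), norm_nonneg (a j), norm_nonneg (b j)])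
    (ha.add hb)

/-- If the defect is absorbed into the kernel of the coordinate `x₀` with the help of the
Szegő kernel, a decomposition with a defect becomes one without. -/
theorem HasDefectDecomposition.exists_decomposition {x : ℕ → α → ℂ} {M : α → α → ℂ}
    (h : HasDefectDecomposition x M) (hx : ∀ z, ‖x 0 z‖ < 1) :
    ∃ K : ℕ → α → α → ℂ, (∀ j, IsPSD (K j)) ∧
      (∀ z w, HasSum (fun j => (1 - x j z * conj (x j w)) * K j z w) (M z w)) ∧
      ∀ z, Summable fun j => K j z z := by
  obtain ⟨K, P, hK, hP, hs, hM⟩ := h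
  have hQ := hP.szego_mul hx
  let Q : ℕ → α → α → ℂ := fun j z w =>
    if j = 0 then (1 - x 0 z * conj (x 0 w))⁻¹ * P z w else 0
  have hQs (z w : α) : HasSum (fun j => Q j z w) (Q 0 z w) :=
    hasSum_single 0 fun j hj => if_neg hj
  refine ⟨fun j z w => K j z w + Q j z w, fun j => (hK j).add ?_, fun z w => ?_,
    fun z => (hs z).add (hQs z z).summable⟩
  · rcases eq_or_ne j 0 with rfl | hj
    · simpa only [Q, if_true] using hQ
    · simpa only [Q, if_neg hj] using isPSD_zero
  · have hne : 1 - x 0 z * conj (x 0 w) ≠ 0 := by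
      intro h0
      have h1 : ‖x 0 z * conj (x 0 w)‖ = 1 := by rw [← sub_eq_zero.1 h0, norm_one]
      rw [norm_mul, RCLike.norm_conj] at h1
      exact (mul_lt_one_of_nonneg_of_lt_one_left (norm_nonneg _) (hx z) (hx w).le).ne h1
    have h2 : HasSum (fun j => (1 - x j z * conj (x j w)) * Q j z w) (P z w) := by
      have := hasSum_single (f := fun j => (1 - x j z * conj (x j w)) * Q j z w) 0
        fun j hj => by simp [Q, hj]
      simpa only [Q, if_true, mul_inv_cancel_left₀ hne] using this
    have h3 := (hM z w).add h2
    simpa only [mul_add, sub_add_cancel] using h3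

theorem exists_tendsto_of_norm_le {I : Type*} (u : Ultrafilter I) {g : I → ℂ} {C : ℝ}
    (h : ∀ᶠ n in u, ‖g n‖ ≤ C) : ∃ l, Tendsto g u (𝓝 l) := by
  obtain ⟨l, -, hl⟩ := (isCompact_closedBall (0 : ℂ) C).ultrafilter_le_nhds (u.map g)
    (le_principal_iff.2 (h.mono fun n hn => by simpa using hn))
  exact ⟨l, hl⟩

/-- The diagonal bounds the total mass: `P(z,z)` and `∑ⱼ Kⱼ(z,z)` are controlled by `M(z,z)`. -/
theorem diag_le_of_hasSum {x : ℕ → α → ℂ} {K : ℕ → α → α → ℂ} {P : α → α → ℂ}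
    (hK : ∀ j, IsPSD (K j)) (hP : IsPSD P) (hs : ∀ z, Summable fun j => K j z z) {z : α} {r : ℝ}
    (hr : r < 1) (hx : ∀ j, ‖x j z‖ ≤ r) {m : ℂ} {C : ℝ} (hm : ‖m‖ ≤ C)
    (h : HasSum (fun j => (1 - x j z * conj (x j z)) * K j z z) (m - P z z)) :
    (P z z).re ≤ C / (1 - r ^ 2) ∧ ∑' j, (K j z z).re ≤ C / (1 - r ^ 2) := by
  have hr0 : 0 ≤ r := (norm_nonneg _).trans (hx 0)
  have hr2 : 0 < 1 - r ^ 2 := by nlinarith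
  have hre := Complex.hasSum_re h
  have hterm (j : ℕ) : (1 - r ^ 2) * (K j z z).re ≤
      ((1 - x j z * conj (x j z)) * K j z z).re := by
    rw [Complex.mul_conj, (hK j).diag_eq_re z]
    rw [Complex.normSq_eq_norm_sq]
    norm_cast
    have := hx j
    have := norm_nonneg (x j z)
    gcongr
    exact (hK j).diag_re_nonneg z
  have hsr := Complex.reCLM.summable (hs z)
  have h1 : (1 - r ^ 2) * ∑' j, (K j z z).re ≤ (m - P z z).re := by
    rw [← tsum_mul_left]
    exact (hasSum_le hterm (hsr.mul_left _).hasSum hre)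
  have h2 : 0 ≤ ∑' j, (K j z z).re := tsum_nonneg fun j => (hK j).diag_re_nonneg z
  have h3 : m.re ≤ C := (Complex.re_le_norm m).trans hm
  have h4 := hP.diag_re_nonneg z
  rw [Complex.sub_re] at h1
  have h5 := mul_nonneg hr2.le h2
  constructor
  · rw [le_div_iff₀ hr2]
    nlinarith [sq_nonneg r]
  · rw [le_div_iff₀ hr2]
    linarith

/-- Limits of decompositions with a defect along an ultrafilter. Square-summability of the points
makes the series `∑ⱼ xⱼ(z) conj (xⱼ(w)) Kⱼ(z,w)` converge uniformly, so that only mass in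
`∑ⱼ Kⱼ` itself can escape to infinity; it goes into the defect. -/
theorem HasDefectDecomposition.of_tendsto {I : Type*} (u : Ultrafilter I) {x : ℕ → α → ℂ}
    (hx1 : ∀ z, ∃ r < 1, ∀ j, ‖x j z‖ ≤ r) (hx2 : ∀ z, Summable fun j => ‖x j z‖ ^ 2)
    {K : I → ℕ → α → α → ℂ} {P m : I → α → α → ℂ} {M : α → α → ℂ}
    (hK : ∀ n j, IsPSD (K n j)) (hP : ∀ n, IsPSD (P n)) (hs : ∀ n z, Summable fun j => K n j z z)
    (h : ∀ z w, ∀ᶠ n in u,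
      HasSum (fun j => (1 - x j z * conj (x j w)) * K n j z w) (m n z w - P n z w))
    (hm : ∀ z w, Tendsto (fun n => m n z w) u (𝓝 (M z w))) : HasDefectDecomposition x M := by
  have hB (z : α) : ∃ B, ∀ᶠ n in u, (P n z z).re ≤ B ∧ ∑' j, (K n j z z).re ≤ B := by
    obtain ⟨r, hr, hxr⟩ := hx1 z
    refine ⟨(‖M z z‖ + 1) / (1 - r ^ 2), ?_⟩
    filter_upwards [h z z, (hm z z).norm.eventually_lt_const (lt_add_one _)] with n hn hn'
    exact diag_le_of_hasSum (hK n) (hP n) (hs n) hr hxr hn'.le hn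
  choose B hB using hB
  have hsn (n : I) (z w : α) := summable_norm_of_diag (hK n) (hs n) z w
  have hsr (n : I) (z : α) : Summable fun j => (K n j z z).re := Complex.reCLM.summable (hs n z)
  have htot (z w : α) : ∀ᶠ n in u, ∑' j, ‖K n j z w‖ ≤ (B z + B w) / 2 := by
    filter_upwards [hB z, hB w] with n hz hw
    have h1 : ∑' j, ‖K n j z w‖ ≤ ∑' j, ((K n j z z).re + (K n j w w).re) / 2 :=
      (hsn n z w).tsum_le_tsum (fun j => (hK n j).norm_le z w)
        (((hsr n z).add (hsr n w)).div_const 2)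
    rw [tsum_div_const, (hsr n z).tsum_add (hsr n w)] at h1
    linarith [hz.2, hw.2]
  have hle (z w : α) : ∀ᶠ n in u, ∀ j, ‖K n j z w‖ ≤ (B z + B w) / 2 := by
    filter_upwards [htot z w] with n hn j
    exact ((hsn n z w).le_tsum j fun _ _ => norm_nonneg _).trans hn
  have hKl (j : ℕ) (z w : α) : ∃ l, Tendsto (fun n => K n j z w) u (𝓝 l) :=
    exists_tendsto_of_norm_le u ((hle z w).mono fun n hn => hn j)
  have hSl (z w : α) : ∃ l, Tendsto (fun n => ∑' j, K n j z w) u (𝓝 l) :=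
    exists_tendsto_of_norm_le u ((htot z w).mono fun n hn =>
      (norm_tsum_le_tsum_norm (hsn n z w)).trans hn)
  have hPl (z w : α) : ∃ l, Tendsto (fun n => P n z w) u (𝓝 l) := by
    refine exists_tendsto_of_norm_le u (C := (B z + B w) / 2) ?_
    filter_upwards [hB z, hB w] with n hz hw
    linarith [(hP n).norm_le z w, hz.1, hw.1]
  choose Kl hKl using hKl
  choose Sl hSl using hSl
  choose Pl hPl using hPl
  have hKlP (j : ℕ) : IsPSD (Kl j) :=
    IsPSD.of_tendsto (Eventually.of_forall fun n => hK n j) (hKl j)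
  have hPlP : IsPSD Pl := IsPSD.of_tendsto (Eventually.of_forall hP) hPl
  have hKls (z : α) : Summable fun j => Kl j z z := by
    have hre : Summable fun j => (Kl j z z).re := by
      refine summable_of_sum_le (c := B z) (fun j => (hKlP j).diag_re_nonneg z) fun F => ?_
      refine le_of_tendsto (tendsto_finsetSum F fun j _ =>
        (Complex.continuous_re.tendsto _).comp (hKl j z z)) ?_
      filter_upwards [hB z] with n hn
      exact ((hsr n z).sum_le_tsum F fun j _ => (hK n j).diag_re_nonneg z).trans hn.2
    have h1 := Complex.ofRealCLM.summable hre
    refine h1.congr fun j => ?_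
    simp [← (hKlP j).diag_eq_re z]
  have hKln := summable_norm_of_diag hKlP hKls
  let Q : α → α → ℂ := fun z w => Sl z w - ∑' j, Kl j z w
  have hQ : IsPSD Q := by
    have hF (F : Finset ℕ) : IsPSD fun z w => Sl z w - ∑ j ∈ F, Kl j z w := by
      have h1 (n : I) : IsPSD fun z w => (∑' j, K n j z w) - ∑ j ∈ F, K n j z w := by
        refine IsPSD.of_hasSum (fun j : {j // j ∉ F} => hK n j) fun z w => ?_
        refine (Finset.hasSum_compl_iff (f := fun j => K n j z w) F).2 ?_
        simpa using (hsn n z w).of_norm.hasSum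
      exact IsPSD.of_tendsto (Eventually.of_forall h1) fun z w =>
        (hSl z w).sub (tendsto_finsetSum F fun j _ => hKl j z w)
    exact IsPSD.of_tendsto (Eventually.of_forall hF) fun z w =>
      tendsto_const_nhds.sub (hKln z w).of_norm.hasSum
  refine ⟨Kl, fun z w => Pl z w + Q z w, hKlP, hPlP.add hQ, hKls, fun z w => ?_⟩
  have hxlt (z : α) (j : ℕ) : ‖x j z‖ ≤ 1 := by
    obtain ⟨r, hr, hxr⟩ := hx1 z
    exact (hxr j).trans hr.le
  have hcs {k : ℕ → ℂ} (hk : Summable fun j => ‖k j‖) :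
      Summable fun j => x j z * conj (x j w) * k j := by
    refine Summable.of_norm_bounded hk fun j => ?_
    rw [norm_mul, norm_mul, RCLike.norm_conj]
    exact mul_le_of_le_one_left (norm_nonneg _) (mul_le_one₀ (hxlt z j) (norm_nonneg _) (hxlt w j))
  have hTan : Tendsto (fun n => ∑' j, x j z * conj (x j w) * K n j z w) u
      (𝓝 (∑' j, x j z * conj (x j w) * Kl j z w)) := by
    refine tendsto_tsum_of_dominated_convergence
      (bound := fun j => ‖x j z‖ * ‖x j w‖ * ((B z + B w) / 2))
      ((summable_mul_conj (hx2 z) (hx2 w)).mul_right _) (fun j => (hKl j z w).const_mul _) ?_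
    filter_upwards [hle z w] with n hn j
    rw [norm_mul, norm_mul, RCLike.norm_conj]
    gcongr
    exact hn j
  have hval : Sl z w - ∑' j, x j z * conj (x j w) * Kl j z w = M z w - Pl z w := by
    refine tendsto_nhds_unique ((hSl z w).sub hTan)
      (((hm z w).sub (hPl z w)).congr' ?_)
    filter_upwards [h z w] with n hn
    rw [← hn.tsum_eq, ← (hsn n z w).of_norm.tsum_sub (hcs (hsn n z w))]
    exact tsum_congr fun j => by ring
  have h1 := (hKln z w).of_norm.hasSum.sub (hcs (hKln z w)).hasSum
  have h2 : M z w - (Pl z w + Q z w) =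
      ∑' j, Kl j z w - ∑' j, x j z * conj (x j w) * Kl j z w := by
    simp only [Q]
    linear_combination -hval
  rw [h2]
  exact h1.congr_fun fun j => by ring

/-! ### Separation from the cone of decompositions -/

theorem HasDefectDecomposition.add {x : ℕ → α → ℂ} {M N : α → α → ℂ}
    (hM : HasDefectDecomposition x M) (hN : HasDefectDecomposition x N) :
    HasDefectDecomposition x (M + N) := by
  obtain ⟨K, P, hK, hP, hs, h⟩ := hM
  obtain ⟨K', P', hK', hP', hs', h'⟩ := hN
  refine ⟨fun j z w => K j z w + K' j z w, fun z w => P z w + P' z w,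
    fun j => (hK j).add (hK' j), hP.add hP', fun z => (hs z).add (hs' z), fun z w => ?_⟩
  have h1 := (h z w).add (h' z w)
  simp only [← mul_add] at h1
  convert! h1 using 1
  simp only [Pi.add_apply]
  ring

theorem HasDefectDecomposition.smul {x : ℕ → α → ℂ} {M : α → α → ℂ}
    (hM : HasDefectDecomposition x M) {t : ℝ} (ht : 0 ≤ t) :
    HasDefectDecomposition x (t • M) := by
  obtain ⟨K, P, hK, hP, hs, h⟩ := hM
  refine ⟨fun j z w => t * K j z w, fun z w => t * P z w,
    fun j => (hK j).const_mul ht, hP.const_mul ht, fun z => (hs z).mul_left _, fun z w => ?_⟩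
  have h1 := (h z w).mul_left (t : ℂ)
  convert! h1 using 1
  · funext j
    ring
  · simp only [Pi.smul_apply, Complex.real_smul]
    ring

theorem IsPSD.hasDefectDecomposition {x : ℕ → α → ℂ} {P : α → α → ℂ} (hP : IsPSD P) :
    HasDefectDecomposition x P :=
  ⟨fun _ _ _ => 0, P, fun _ => isPSD_zero, hP, fun _ => summable_zero, fun z w => by simp⟩

theorem IsPSD.hasDefectDecomposition_mul {x : ℕ → α → ℂ} {P : α → α → ℂ} (hP : IsPSD P) (j : ℕ) :
    HasDefectDecomposition x fun z w => (1 - x j z * conj (x j w)) * P z w := by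
  classical
  refine ⟨fun i z w => if i = j then P z w else 0, fun _ _ => 0, fun i => ?_, isPSD_zero,
    fun z => (hasSum_ite_eq j (P z z)).summable, fun z w => ?_⟩
  · by_cases hi : i = j
    · simpa only [if_pos hi] using hP
    · simpa only [if_neg hi] using isPSD_zero
  · have h := hasSum_single (f := fun i => (1 - x i z * conj (x i w)) * if i = j then P z w else 0)
      j fun i hi => by simp [hi]
    simpa using h

theorem isClosed_hasDefectDecomposition [Fintype α] {x : ℕ → α → ℂ}
    (hx1 : ∀ z, ∃ r < 1, ∀ j, ‖x j z‖ ≤ r) (hx2 : ∀ z, Summable fun j => ‖x j z‖ ^ 2) :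
    IsClosed {M : α → α → ℂ | HasDefectDecomposition x M} := by
  refine isClosed_iff_ultrafilter.2 fun M u huM hu => ?_
  have hex (N : α → α → ℂ) : ∃ (K : ℕ → α → α → ℂ) (P : α → α → ℂ), (∀ j, IsPSD (K j)) ∧
      IsPSD P ∧ (∀ z, Summable fun j => K j z z) ∧ (HasDefectDecomposition x N →
        ∀ z w, HasSum (fun j => (1 - x j z * conj (x j w)) * K j z w) (N z w - P z w)) := by
    by_cases hN : HasDefectDecomposition x N
    · obtain ⟨K, P, hK, hP, hs, h⟩ := hN
      exact ⟨K, P, hK, hP, hs, fun _ => h⟩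
    · exact ⟨fun _ _ _ => 0, fun _ _ => 0, fun _ => isPSD_zero, isPSD_zero,
        fun _ => summable_zero, fun h => absurd h hN⟩
  choose K P hK hP hs h using hex
  refine HasDefectDecomposition.of_tendsto u hx1 hx2 (m := fun N => N) hK hP hs (fun z w => ?_)
    fun z w => ?_
  · filter_upwards [hu] with N hN using h N hN z w
  · exact tendsto_pi_nhds.1 (tendsto_pi_nhds.1 huM z) w

theorem isPSD_of_re_nonneg [Fintype α] {A : α → α → ℂ} (hA : ∀ z w, conj (A w z) = A z w)
    (h : ∀ a : α → ℂ, 0 ≤ (∑ z, ∑ w, a z * conj (a w) * A z w).re) : IsPSD A := by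
  classical
  intro Y a
  have him (b : α → ℂ) : (∑ z ∈ Y, ∑ w ∈ Y, b z * conj (b w) * A z w).im = 0 := by
    rw [← Complex.conj_eq_iff_im]
    simp only [map_sum, map_mul, Complex.conj_conj, hA]
    rw [Finset.sum_comm]
    exact Finset.sum_congr rfl fun _ _ => Finset.sum_congr rfl fun _ _ => by ring
  refine Complex.le_def.2 ⟨?_, (him a).symm⟩
  refine (h fun z => if z ∈ Y then a z else 0).trans_eq (congrArg _ ?_)
  rw [← Finset.sum_subset (Finset.subset_univ Y)]
  · refine Finset.sum_congr rfl fun z hz => ?_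
    rw [← Finset.sum_subset (Finset.subset_univ Y)]
    · exact Finset.sum_congr rfl fun w hw => by simp [hz, hw]
    · intro w _ hw
      simp [hw]
  · intro z _ hz
    simp [hz]

/-- A positive definite matrix is the Gram matrix of a basis, given by the columns of `S`. -/
theorem exists_isUnit_conjTranspose_mul_self [Fintype α] [DecidableEq α] {G : Matrix α α ℂ}
    (hG : G.PosDef) : ∃ S : Matrix α α ℂ, IsUnit S ∧ G = S.conjTranspose * S := by
  open scoped MatrixOrder in
  obtain ⟨S, hS⟩ := CStarAlgebra.nonneg_iff_eq_star_mul_self.mp hG.posSemidef.nonneg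
  rw [Matrix.star_eq_conjTranspose] at hS
  refine ⟨S, ?_, hS⟩
  have h := (Matrix.isUnit_iff_isUnit_det _).1 hG.isUnit
  rw [hS, Matrix.det_mul] at h
  exact (Matrix.isUnit_iff_isUnit_det _).2 (isUnit_of_mul_isUnit_right h)

/-- The functional on kernels obtained by separating `M` from the cone of kernels that have a
decomposition is given by a positive semi-definite matrix `G`. -/
theorem exists_separating_kernel [Fintype α] {x : ℕ → α → ℂ}
    (hx1 : ∀ z, ∃ r < 1, ∀ j, ‖x j z‖ ≤ r) (hx2 : ∀ z, Summable fun j => ‖x j z‖ ^ 2)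
    {M : α → α → ℂ} (hM : ∀ z w, conj (M w z) = M z w) (hnot : ¬ HasDefectDecomposition x M) :
    ∃ G : α → α → ℂ, IsPSD G ∧ (∀ j, IsPSD fun z w => (1 - x j z * conj (x j w)) * G z w) ∧
      (∑ z, ∑ w, M z w * G z w).re < 0 := by
  classical
  have hconv : Convex ℝ {M : α → α → ℂ | HasDefectDecomposition x M} :=
    fun A hA B hB s t hs ht _ => (HasDefectDecomposition.smul hA hs).add
      (HasDefectDecomposition.smul hB ht)
  obtain ⟨ℓ, c, hc, hcM⟩ := RCLike.geometric_hahn_banach_closed_point (𝕜 := ℂ) hconv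
    (isClosed_hasDefectDecomposition hx1 hx2) hnot
  simp only [RCLike.re_to_complex, Set.mem_ofPred_eq] at hc hcM
  have hc0 : 0 < c := by
    have := hc _ (isPSD_zero (α := α)).hasDefectDecomposition
    rw [show (fun _ _ => 0 : α → α → ℂ) = 0 from rfl, map_zero] at this
    simpa using this
  have hneg (A : α → α → ℂ) (hA : HasDefectDecomposition x A) : (ℓ A).re ≤ 0 := by
    by_contra! hpos
    have h := hc _ (hA.smul (t := c / (ℓ A).re) (by positivity))
    have h2 : ℓ ((c / (ℓ A).re) • A) = ((c / (ℓ A).re : ℝ) : ℂ) * ℓ A := by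
      rw [← smul_eq_mul, ← map_smul]
      congr 1
    rw [h2, Complex.re_ofReal_mul, div_mul_cancel₀ _ hpos.ne'] at h
    exact lt_irrefl _ h
  let Γ : α → α → ℂ := fun z w => ℓ (Pi.single z (Pi.single w 1))
  have hℓ (A : α → α → ℂ) : ℓ A = ∑ z, ∑ w, A z w * Γ z w := by
    have hA : A = ∑ z, ∑ w, A z w • (Pi.single z (Pi.single w 1) : α → α → ℂ) := by
      ext z w
      simp [Finset.sum_apply, Pi.single_apply, Finset.sum_ite_eq, ite_apply]
    conv_lhs => rw [hA]
    simp only [map_sum, map_smul, smul_eq_mul, Γ]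
  let G : α → α → ℂ := fun z w => -(Γ z w + conj (Γ w z)) / 2
  have hGH (z w : α) : conj (G w z) = G z w := by
    simp [G, add_comm, map_ofNat]
  have hre (A : α → α → ℂ) (hA : ∀ z w, conj (A w z) = A z w) :
      (∑ z, ∑ w, A z w * G z w).re = -(ℓ A).re := by
    have h1 : conj (ℓ A) = ∑ z, ∑ w, A z w * conj (Γ w z) := by
      rw [hℓ, Finset.sum_comm]
      simp only [map_sum, map_mul, hA]
    have h2 : ∑ z, ∑ w, A z w * G z w = -(ℓ A + conj (ℓ A)) / 2 := by
      rw [h1, hℓ, ← Finset.sum_add_distrib, ← Finset.sum_neg_distrib, Finset.sum_div]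
      refine Finset.sum_congr rfl fun z _ => ?_
      rw [← Finset.sum_add_distrib, ← Finset.sum_neg_distrib, Finset.sum_div]
      refine Finset.sum_congr rfl fun w _ => ?_
      simp only [G]
      ring
    rw [h2, Complex.add_conj]
    simp
    ring
  refine ⟨G, isPSD_of_re_nonneg hGH fun a => ?_, fun j => isPSD_of_re_nonneg (fun z w => ?_)
    fun a => ?_, ?_⟩
  · have h := hneg _ (isPSD_rankOne a).hasDefectDecomposition
    rw [hre _ (isPSD_rankOne a).isHermitian]
    linarith
  · simp only [map_mul, map_sub, map_one, Complex.conj_conj, hGH]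
    ring
  · have h := hneg _ ((isPSD_rankOne a).hasDefectDecomposition_mul j)
    have h2 := hre (fun z w => (1 - x j z * conj (x j w)) * (a z * conj (a w))) fun z w => by
      simp only [map_mul, map_sub, map_one, Complex.conj_conj]
      ring
    have h3 : ∑ z, ∑ w, a z * conj (a w) * ((1 - x j z * conj (x j w)) * G z w) =
        ∑ z, ∑ w, (1 - x j z * conj (x j w)) * (a z * conj (a w)) * G z w :=
      Finset.sum_congr rfl fun _ _ => Finset.sum_congr rfl fun _ _ => by ring
    rw [h3, h2]
    linarith
  · rw [hre M hM]
    linarith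

/-- Duality: `M` has a decomposition as soon as it pairs nonnegatively with the Gram matrix of
every basis of joint eigenvectors of a tuple of contractions with joint eigenvalues `xⱼ(z)`. -/
theorem hasDefectDecomposition_of_forall_basis [Fintype α] [DecidableEq α] {x : ℕ → α → ℂ}
    (hx1 : ∀ z, ∃ r < 1, ∀ j, ‖x j z‖ ≤ r) (hx2 : ∀ z, Summable fun j => ‖x j z‖ ^ 2)
    {M : α → α → ℂ} (hM : ∀ z w, conj (M w z) = M z w)
    (h : ∀ S : Matrix α α ℂ, IsUnit S →
      (∀ j, IsPSD fun z w => (1 - x j z * conj (x j w)) * (S.conjTranspose * S) w z) →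
      0 ≤ (∑ z, ∑ w, M z w * (S.conjTranspose * S) w z).re) :
    HasDefectDecomposition x M := by
  by_contra hnot
  obtain ⟨G, hG, hGx, hGM⟩ := exists_separating_kernel hx1 hx2 hM hnot
  -- The identity matrix lies in the dual cone, so that `G` may be made definite by adding `ε`.
  have hε (ε : ℝ) (hε : 0 < ε) :
      0 ≤ (∑ z, ∑ w, M z w * G z w).re + ε * (∑ z, M z z).re := by
    have hpd : ((Matrix.of G).transpose + ε • (1 : Matrix α α ℂ)).PosDef :=
      Matrix.PosDef.posSemidef_add (isPSD_iff.1 hG).transpose (Matrix.PosDef.one.smul hε)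
    obtain ⟨S, hS, hGS⟩ := exists_isUnit_conjTranspose_mul_self hpd
    have hent (z w : α) : (S.conjTranspose * S) w z = G z w + ε * if z = w then 1 else 0 := by
      rw [← hGS]
      simp [Matrix.one_apply, eq_comm]
    have h1 := h S hS fun j => by
      have hD : IsPSD fun z w : α =>
          (1 - x j z * conj (x j w)) * (ε * if z = w then 1 else 0) := by
        refine isPSD_iff.2 ?_
        have : Matrix.of (fun z w : α =>
            (1 - x j z * conj (x j w)) * ((ε : ℂ) * if z = w then 1 else 0)) =
            Matrix.diagonal fun z => (1 - x j z * conj (x j z)) * (ε : ℂ) := by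
          ext z w
          by_cases hzw : z = w
          · subst hzw
            simp
          · simp [hzw]
        rw [this, Matrix.posSemidef_diagonal_iff]
        intro z
        obtain ⟨r, hr, hxr⟩ := hx1 z
        rw [Complex.mul_conj, Complex.normSq_eq_norm_sq]
        have h2 : 0 ≤ (1 - ‖x j z‖ ^ 2) * ε := by
          have := hxr j
          have := norm_nonneg (x j z)
          have : 0 ≤ 1 - ‖x j z‖ ^ 2 := by nlinarith
          positivity
        exact_mod_cast h2
      have h2 := (hGx j).add hD
      simpa only [hent, mul_add] using h2
    have h2 : ∑ z, ∑ w, M z w * (S.conjTranspose * S) w z =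
        ∑ z, ∑ w, M z w * G z w + ε * ∑ z, M z z := by
      simp only [hent, mul_add, Finset.sum_add_distrib, Finset.mul_sum]
      congr 1
      refine Finset.sum_congr rfl fun z _ => ?_
      rw [Finset.sum_eq_single z]
      · simp [mul_comm]
      · intro w _ hw
        simp [Ne.symm hw]
      · simp
    rw [h2, Complex.add_re, Complex.re_ofReal_mul] at h1
    exact h1
  have hlim : Tendsto (fun ε : ℝ => (∑ z, ∑ w, M z w * G z w).re + ε * (∑ z, M z z).re)
      (𝓝[>] 0) (𝓝 ((∑ z, ∑ w, M z w * G z w).re + 0 * (∑ z, M z z).re)) :=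
    ((tendsto_id.mul_const _).const_add _).mono_left nhdsWithin_le_nhds
  have h0 := ge_of_tendsto hlim (eventually_mem_nhdsWithin.mono fun ε h => hε ε h)
  linarith

/-! ### Diagonalizable tuples and the matrix von Neumann inequality -/

theorem sum_conjTranspose_mul_self [Fintype α] [DecidableEq α] (S : Matrix α α ℂ) (a : α → ℂ) :
    ∑ z, ∑ w, a z * conj (a w) * (S.conjTranspose * S) w z =
      ((‖WithLp.toLp 2 (S.mulVec a)‖ ^ 2 : ℝ) : ℂ) := by
  have h : ((‖WithLp.toLp 2 (S.mulVec a)‖ ^ 2 : ℝ) : ℂ) =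
      ∑ i, S.mulVec a i * conj (S.mulVec a i) := by
    rw [EuclideanSpace.norm_sq_eq]
    push_cast
    exact Finset.sum_congr rfl fun i _ => (Complex.mul_conj' _).symm
  rw [h]
  simp only [Matrix.mul_apply, Matrix.conjTranspose_apply, Matrix.mulVec, dotProduct, map_sum,
    map_mul, RCLike.star_def]
  simp only [Finset.sum_mul_sum]
  simp only [Finset.mul_sum]
  rw [Finset.sum_comm_cycle]
  refine Finset.sum_congr rfl fun i _ => ?_
  refine Finset.sum_congr rfl fun z _ => Finset.sum_congr rfl fun w _ => ?_
  ring

/-- The matrix with eigenvalues `d` on the columns of `S` is a contraction if and only if the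
Gram kernel of the columns, multiplied by `1 - d d*`, is positive semi-definite. -/
theorem norm_conj_diagonal_le_one_iff [Fintype α] [DecidableEq α] {S : Matrix α α ℂ}
    (hS : IsUnit S) (d : α → ℂ) :
    ‖Matrix.toEuclideanCLM (n := α) (𝕜 := ℂ) (S * Matrix.diagonal d * S⁻¹)‖ ≤ 1 ↔
      IsPSD fun z w => (1 - d z * conj (d w)) * (S.conjTranspose * S) w z := by
  have hdet := (Matrix.isUnit_iff_isUnit_det S).1 hS
  have hform (a : α → ℂ) :
      ∑ z, ∑ w, a z * conj (a w) * ((1 - d z * conj (d w)) * (S.conjTranspose * S) w z) =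
      ((‖WithLp.toLp 2 (S.mulVec a)‖ ^ 2 -
        ‖WithLp.toLp 2 (S.mulVec fun z => d z * a z)‖ ^ 2 : ℝ) : ℂ) := by
    rw [Complex.ofReal_sub, ← sum_conjTranspose_mul_self, ← sum_conjTranspose_mul_self,
      ← Finset.sum_sub_distrib]
    refine Finset.sum_congr rfl fun z _ => ?_
    rw [← Finset.sum_sub_distrib]
    refine Finset.sum_congr rfl fun w _ => ?_
    rw [map_mul]
    ring
  have hact (a : α → ℂ) : (S * Matrix.diagonal d * S⁻¹).mulVec (S.mulVec a) =
      S.mulVec fun z => d z * a z := by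
    rw [Matrix.mulVec_mulVec, Matrix.nonsing_inv_mul_cancel_right _ _ hdet, ← Matrix.mulVec_mulVec]
    congr 1
    ext z
    rw [Matrix.mulVec_diagonal]
  constructor
  · intro h
    refine isPSD_of_re_nonneg (fun z w => ?_) fun a => ?_
    · have : conj ((S.conjTranspose * S) z w) = (S.conjTranspose * S) w z :=
        congrFun (congrFun (Matrix.isHermitian_conjTranspose_mul_self S) w) z
      simp only [map_mul, map_sub, map_one, Complex.conj_conj, this]
      ring
    · rw [hform, Complex.ofReal_re, sub_nonneg]
      have h1 := ContinuousLinearMap.le_of_opNorm_le _ h (WithLp.toLp 2 (S.mulVec a))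
      rw [Matrix.toEuclideanCLM_toLp, hact, one_mul] at h1
      gcongr
  · intro h
    refine ContinuousLinearMap.opNorm_le_bound _ zero_le_one fun v => ?_
    have hv : WithLp.toLp 2 (S.mulVec (S⁻¹.mulVec v.ofLp)) = v := by
      rw [Matrix.mulVec_mulVec, Matrix.mul_nonsing_inv _ hdet, Matrix.one_mulVec]
    have h1 := h Finset.univ (S⁻¹.mulVec v.ofLp)
    rw [hform, Complex.zero_le_real, sub_nonneg] at h1
    rw [one_mul, ← hv, Matrix.toEuclideanCLM_toLp, hact]
    exact (pow_le_pow_iff_left₀ (norm_nonneg _) (norm_nonneg _) two_ne_zero).1 h1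

theorem mem_jointEigenspace_iff {n : ℕ} {T : ℕ → Matrix (Fin n) (Fin n) ℂ} {z : ℕ → ℂ}
    {v : Fin n → ℂ} : v ∈ jointEigenspace T z ↔ ∀ j, (T j).mulVec v = z j • v := by
  simp [jointEigenspace, Submodule.mem_iInf]

/-- The joint eigenvectors of a diagonal tuple, in the coordinates of the eigenbasis. -/
theorem mem_jointEigenspace_conj_diagonal_iff {n : ℕ} {S : Matrix (Fin n) (Fin n) ℂ}
    (hS : IsUnit S) {d : ℕ → Fin n → ℂ} {z : ℕ → ℂ} {v : Fin n → ℂ} :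
    v ∈ jointEigenspace (fun j => S * Matrix.diagonal (d j) * S⁻¹) z ↔
      ∀ i, (S⁻¹.mulVec v) i ≠ 0 → ∀ j, d j i = z j := by
  have hdet := (Matrix.isUnit_iff_isUnit_det S).1 hS
  have key (j : ℕ) : (S * Matrix.diagonal (d j) * S⁻¹).mulVec v = z j • v ↔
      (Matrix.diagonal (d j)).mulVec (S⁻¹.mulVec v) = z j • S⁻¹.mulVec v := by
    rw [← Matrix.mulVec_mulVec, ← Matrix.mulVec_mulVec, ← Matrix.mulVec_smul]
    constructor
    · intro h
      have := congrArg S⁻¹.mulVec h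
      rwa [Matrix.mulVec_mulVec, Matrix.nonsing_inv_mul _ hdet, Matrix.one_mulVec] at this
    · intro h
      rw [h, Matrix.mulVec_mulVec, Matrix.mul_nonsing_inv _ hdet, Matrix.one_mulVec]
  rw [mem_jointEigenspace_iff]
  simp only [key, funext_iff, Matrix.mulVec_diagonal, Pi.smul_apply, smul_eq_mul,
    mul_eq_mul_right_iff]
  constructor
  · intro h i hi j
    exact (h j i).resolve_right hi
  · intro h j i
    by_cases hi : S⁻¹.mulVec v i = 0
    · exact Or.inr hi
    · exact Or.inl (h i hi j)

theorem isFunctionOf_conj_diagonal {n : ℕ} {X : Set EllInfty} (f : X → ℂ)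
    {S : Matrix (Fin n) (Fin n) ℂ} (hS : IsUnit S) (p : Fin n → X) :
    IsFunctionOf f (fun j => S * Matrix.diagonal (fun i => (p i).1 j) * S⁻¹)
      (S * Matrix.diagonal (fun i => f (p i)) * S⁻¹) := by
  have hdet := (Matrix.isUnit_iff_isUnit_det S).1 hS
  intro z v hv
  rw [mem_jointEigenspace_conj_diagonal_iff hS] at hv
  have h : (Matrix.diagonal fun i => f (p i)).mulVec (S⁻¹.mulVec v) = f z • S⁻¹.mulVec v := by
    ext i
    rw [Matrix.mulVec_diagonal, Pi.smul_apply, smul_eq_mul]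
    by_cases hi : S⁻¹.mulVec v i = 0
    · rw [hi, mul_zero, mul_zero]
    · rw [show p i = z from Subtype.ext (lp.ext (funext fun j => hv i hi j))]
  rw [← Matrix.mulVec_mulVec, ← Matrix.mulVec_mulVec, h, Matrix.mulVec_smul, Matrix.mulVec_mulVec,
    Matrix.mul_nonsing_inv _ hdet, Matrix.one_mulVec]

/-- An Agler decomposition implies the matrix von Neumann inequality, by the Schur product
theorem. -/
theorem HasAglerDecomposition.satisfiesMatrixVonNeumann {X : Set EllInfty} {f : X → ℂ}
    (h : HasAglerDecomposition X f) : SatisfiesMatrixVonNeumann X f := by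
  obtain ⟨K, hK, hM, -⟩ := h
  intro n T _ hT ⟨S, hS, hdiag⟩ _ hσ
  have hdet := (Matrix.isUnit_iff_isUnit_det S).1 hS
  let D (j : ℕ) : Fin n → ℂ := (S⁻¹ * T j * S).diag
  have hD (j : ℕ) : S⁻¹ * T j * S = Matrix.diagonal (D j) :=
    ((Matrix.isDiag_iff_diagonal_diag _).1 (hdiag j)).symm
  have hTD : T = fun j => S * Matrix.diagonal (D j) * S⁻¹ := by
    funext j
    rw [← hD, ← Matrix.mul_assoc, ← Matrix.mul_assoc, Matrix.mul_nonsing_inv _ hdet,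
      Matrix.one_mul, Matrix.mul_assoc, Matrix.mul_nonsing_inv _ hdet, Matrix.mul_one]
  have hp (i : Fin n) : ∃ p : X, ∀ j, D j i = p.1 j := by
    have hmem : (fun j => D j i) ∈ jointSpectrum T := by
      refine (Submodule.ne_bot_iff _).2 ⟨S.mulVec (Pi.single i 1), ?_, fun h0 => ?_⟩
      · rw [hTD, mem_jointEigenspace_conj_diagonal_iff hS]
        intro k hk j
        rw [Matrix.mulVec_mulVec, Matrix.nonsing_inv_mul _ hdet, Matrix.one_mulVec] at hk
        rw [show k = i by by_contra hki; exact hk (Pi.single_eq_of_ne hki _)]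
      · have h1 := congrFun (congrArg S⁻¹.mulVec h0) i
        rw [Matrix.mulVec_mulVec, Matrix.nonsing_inv_mul _ hdet, Matrix.one_mulVec] at h1
        simp at h1
    obtain ⟨p, hpX, hpe⟩ := hσ hmem
    exact ⟨⟨p, hpX⟩, fun j => (congrFun hpe j).symm⟩
  choose p hp using hp
  have hTp : T = fun j => S * Matrix.diagonal (fun i => (p i).1 j) * S⁻¹ := by
    rw [hTD]
    funext j
    rw [show D j = fun i => (p i).1 j from funext fun i => hp i j]
  refine ⟨S * Matrix.diagonal (fun i => f (p i)) * S⁻¹, ?_, ?_⟩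
  · rw [hTp]
    exact isFunctionOf_conj_diagonal f hS p
  · refine (norm_conj_diagonal_le_one_iff hS _).2 ?_
    have hj (j : ℕ) := (norm_conj_diagonal_le_one_iff hS fun i => (p i).1 j).1
      (by have := hT j; rwa [hTp] at this)
    refine IsPSD.of_hasSum (fun j => ((hK j).comp p).mul (hj j)) fun z w => ?_
    have h1 := (hM (p z) (p w)).mul_right ((S.conjTranspose * S) w z)
    exact h1.congr_fun fun j => by ring

/-- In the Hilbert multidisk the matrix von Neumann inequality implies an Agler decomposition: the
bases that the duality theorem asks about are exactly the eigenbases of the admissible tuples. -/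
theorem HasAglerDecomposition.of_satisfiesMatrixVonNeumann {X : Set EllInfty} (hfin : X.Finite)
    {f : X → ℂ} (hX : X ⊆ hilbertMultidisk) (h : SatisfiesMatrixVonNeumann X f) :
    HasAglerDecomposition X f := by
  have := hfin.fintype
  let e := Fintype.equivFin X
  set n := Fintype.card X
  let x : ℕ → Fin n → ℂ := fun j i => (e.symm i).1 j
  have hnorm (p : X) (j : ℕ) : ‖p.1 j‖ ≤ ‖p.1‖ := lp.norm_apply_le_norm (by simp) _ _
  have hlt (p : X) : ‖p.1‖ < 1 := by simpa using (hX p.2).1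
  have hdec : HasDefectDecomposition x
      fun z w => 1 - f (e.symm z) * conj (f (e.symm w)) := by
    refine hasDefectDecomposition_of_forall_basis (fun i => ⟨_, hlt (e.symm i), hnorm _⟩)
      (fun i => (hX (e.symm i).2).2) (fun z w => ?_) fun S hS hSx => ?_
    · simp only [map_sub, map_one, map_mul, Complex.conj_conj]
      ring
    have hdet := (Matrix.isUnit_iff_isUnit_det S).1 hS
    have hcancel (v : Fin n → ℂ) : S.mulVec (S⁻¹.mulVec v) = v := by
      rw [Matrix.mulVec_mulVec, Matrix.mul_nonsing_inv _ hdet, Matrix.one_mulVec]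
    let T : ℕ → Matrix (Fin n) (Fin n) ℂ := fun j => S * Matrix.diagonal (x j) * S⁻¹
    have hcomm (i j : ℕ) : Commute (T i) (T j) := by
      rw [commute_iff_eq]
      simp only [T]
      simp only [← Matrix.mul_assoc, Matrix.nonsing_inv_mul_cancel_right _ _ hdet]
      simp only [Matrix.mul_assoc, Matrix.diagonal_mul_diagonal', mul_comm]
    have hsd : SimultaneouslyDiagonalizable T := by
      refine ⟨S, hS, fun j => ?_⟩
      simp only [T]
      rw [← Matrix.mul_assoc, ← Matrix.mul_assoc, Matrix.nonsing_inv_mul _ hdet, Matrix.one_mul,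
        Matrix.mul_assoc, Matrix.nonsing_inv_mul _ hdet, Matrix.mul_one]
      exact Matrix.isDiag_diagonal _
    have hrank (z : ℕ → ℂ) : Module.finrank ℂ (jointEigenspace T z) ≤ 1 := by
      -- The points of `X` are distinct, so at most one eigenvector belongs to each `z`.
      by_cases hz : ∃ i, ∀ j, x j i = z j
      · obtain ⟨i, hi⟩ := hz
        refine finrank_le_one (⟨S.mulVec (Pi.single i 1), ?_⟩ : jointEigenspace _ z) fun v => ?_
        · rw [mem_jointEigenspace_conj_diagonal_iff hS]
          intro k hk j
          rw [Matrix.mulVec_mulVec, Matrix.nonsing_inv_mul _ hdet, Matrix.one_mulVec] at hk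
          rw [show k = i by by_contra hki; exact hk (Pi.single_eq_of_ne hki _), hi]
        · refine ⟨S⁻¹.mulVec v.1 i, Subtype.ext ?_⟩
          have hv := (mem_jointEigenspace_conj_diagonal_iff hS).1 v.2
          change S⁻¹.mulVec v.1 i • S.mulVec (Pi.single i 1) = v.1
          rw [← Matrix.mulVec_smul]
          refine Eq.trans (congrArg _ ?_) (hcancel v.1)
          ext k
          by_cases hk : k = i
          · subst hk
            simp
          · have : S⁻¹.mulVec v.1 k = 0 := by
              by_contra hne
              refine hk (e.symm.injective (Subtype.ext (lp.ext (funext fun j => ?_))))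
              exact (hv k hne j).trans (hi j).symm
            simp [hk, this]
      · have hbot : jointEigenspace T z = ⊥ := by
          refine (Submodule.eq_bot_iff _).2 fun v hv => ?_
          rw [mem_jointEigenspace_conj_diagonal_iff hS] at hv
          rw [← hcancel v]
          have h0 : S⁻¹.mulVec v = 0 := by
            ext i
            by_contra hi
            exact hz ⟨i, hv i hi⟩
          rw [h0, Matrix.mulVec_zero]
        rw [hbot]
        simp
    have hspec : jointSpectrum T ⊆ (fun x : EllInfty => (x : ℕ → ℂ)) '' X := by
      intro z hz
      obtain ⟨v, hv, hv0⟩ := (Submodule.ne_bot_iff _).1 hz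
      rw [mem_jointEigenspace_conj_diagonal_iff hS] at hv
      have : ∃ i, S⁻¹.mulVec v i ≠ 0 := by
        by_contra! hall
        refine hv0 ?_
        rw [← hcancel v, show S⁻¹.mulVec v = 0 from funext hall, Matrix.mulVec_zero]
      obtain ⟨i, hi⟩ := this
      exact ⟨(e.symm i).1, (e.symm i).2, funext fun j => hv i hi j⟩
    obtain ⟨A, hAf, hA⟩ := h n T hcomm
      (fun j => (norm_conj_diagonal_le_one_iff hS _).2 (hSx j)) hsd hrank hspec
    have hAS : A = S * Matrix.diagonal (fun i => f (e.symm i)) * S⁻¹ := by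
      have h1 : A * S = S * Matrix.diagonal fun i => f (e.symm i) := by
        refine Matrix.ext_of_mulVec_single fun i => ?_
        have h2 := hAf (e.symm i) (S.mulVec (Pi.single i 1)) ?_
        · rw [← Matrix.mulVec_mulVec, h2, ← Matrix.mulVec_mulVec, ← Matrix.mulVec_smul]
          congr 1
          ext k
          rw [Matrix.mulVec_diagonal]
          by_cases hk : k = i
          · subst hk
            simp
          · simp [hk]
        · rw [mem_jointEigenspace_conj_diagonal_iff hS]
          intro k hk j
          rw [Matrix.mulVec_mulVec, Matrix.nonsing_inv_mul _ hdet, Matrix.one_mulVec] at hk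
          rw [show k = i by by_contra hki; exact hk (Pi.single_eq_of_ne hki _)]
      rw [← h1, Matrix.mul_nonsing_inv_cancel_right _ _ hdet]
    rw [IsContraction, hAS, norm_conj_diagonal_le_one_iff hS] at hA
    simpa using (Complex.le_def.1 (hA Finset.univ fun _ => 1)).1
  obtain ⟨K, hK, hM, hs⟩ := hdec.exists_decomposition fun i => (hnorm _ 0).trans_lt (hlt _)
  refine ⟨fun j z w => K j (e z) (e w), fun j => (hK j).comp e, fun z w => ?_, fun z => hs (e z)⟩
  simpa [x] using hM (e z) (e w)

/-! ### Decompositions for functions of the Agler class -/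

theorem opMonomial_apply_of_eigenvector {N : ℕ} {H : Type} [NormedAddCommGroup H]
    [InnerProductSpace ℂ H] {T : Fin N → H →L[ℂ] H} {v : H} {c : Fin N → ℂ}
    (h : ∀ i, T i v = c i • v) (a : Fin N → ℕ) : opMonomial T a v = (∏ i, c i ^ a i) • v := by
  have hpow (i : Fin N) (n : ℕ) : (T i ^ n) v = c i ^ n • v := by
    induction n with
    | zero => simp
    | succ n ih =>
      rw [pow_succ, mul_apply_eq_comp, h, map_smul, ih, smul_smul, pow_succ, mul_comm]
  unfold opMonomial
  induction N with
  | zero => simp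
  | succ N ih =>
    rw [List.ofFn_succ, List.prod_cons, mul_apply_eq_comp,
      ih (fun i => h i.succ) (fun i => a i.succ) (fun i => hpow i.succ), map_smul, hpow,
      smul_smul, Fin.prod_univ_succ, mul_comm]

theorem smul_mem_polydisk {N : ℕ} {z : Fin N → ℂ} (hz : z ∈ polydisk N) {r : ℝ}
    (hr0 : 0 ≤ r) (hr1 : r ≤ 1) : (r : ℂ) • z ∈ polydisk N := by
  intro i
  rw [Pi.smul_apply, norm_smul, Complex.norm_real, Real.norm_of_nonneg hr0]
  nlinarith [hz i, norm_nonneg (z i)]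

/-- The von Neumann inequality for a function of the Agler class, for commuting diagonalizable
contractions that need not be strict. -/
theorem IsAgler.isPSD {N : ℕ} {f : (Fin N → ℂ) → ℂ} (hf : IsAgler f) [Fintype α] [DecidableEq α]
    {y : α → Fin N → ℂ} (hy : ∀ z, y z ∈ polydisk N) {S : Matrix α α ℂ} (hS : IsUnit S)
    (h : ∀ j, IsPSD fun z w => (1 - y z j * conj (y w j)) * (S.conjTranspose * S) w z) :
    IsPSD fun z w => (1 - f (y z) * conj (f (y w))) * (S.conjTranspose * S) w z := by
  obtain ⟨⟨hana, -⟩, c, hc, hT⟩ := hf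
  have hdet := (Matrix.isUnit_iff_isUnit_det S).1 hS
  let s : α → EuclideanSpace ℂ α := fun z => WithLp.toLp 2 (S.mulVec (Pi.single z 1))
  have hact (d : α → ℂ) (z : α) : Matrix.toEuclideanCLM (n := α) (𝕜 := ℂ)
      (S * Matrix.diagonal d * S⁻¹) (s z) = d z • s z := by
    simp only [s, Matrix.toEuclideanCLM_toLp, ← WithLp.toLp_smul]
    rw [Matrix.mulVec_mulVec, Matrix.nonsing_inv_mul_cancel_right _ _ hdet, ← Matrix.mulVec_mulVec,
      ← Matrix.mulVec_smul]
    congr 2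
    ext k
    rw [Matrix.mulVec_diagonal]
    by_cases hk : k = z
    · subst hk
      simp
    · simp [hk]
  have hext {A B : EuclideanSpace ℂ α →L[ℂ] EuclideanSpace ℂ α} (hAB : ∀ z, A (s z) = B (s z)) :
      A = B := by
    have h1 : A * Matrix.toEuclideanCLM (n := α) (𝕜 := ℂ) S =
        B * Matrix.toEuclideanCLM (n := α) (𝕜 := ℂ) S := by
      refine ContinuousLinearMap.coe_injective
        ((EuclideanSpace.basisFun α ℂ).toBasis.ext fun z => ?_)
      simp only [OrthonormalBasis.coe_toBasis, EuclideanSpace.basisFun_apply]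
      exact hAB z
    have h2 : Matrix.toEuclideanCLM (n := α) (𝕜 := ℂ) S *
        Matrix.toEuclideanCLM (n := α) (𝕜 := ℂ) S⁻¹ = 1 := by
      rw [← map_mul, Matrix.mul_nonsing_inv _ hdet, map_one]
    calc A = A * Matrix.toEuclideanCLM (n := α) (𝕜 := ℂ) S *
          Matrix.toEuclideanCLM (n := α) (𝕜 := ℂ) S⁻¹ := by rw [mul_assoc, h2, mul_one]
      _ = B := by rw [h1, mul_assoc, h2, mul_one]
  have hr (r : ℝ) (hr0 : 0 < r) (hr1 : r < 1) : IsPSD fun z w =>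
      (1 - f ((r : ℂ) • y z) * conj (f ((r : ℂ) • y w))) * (S.conjTranspose * S) w z := by
    let T : Fin N → EuclideanSpace ℂ α →L[ℂ] EuclideanSpace ℂ α := fun j =>
      (r : ℂ) • Matrix.toEuclideanCLM (n := α) (𝕜 := ℂ)
        (S * Matrix.diagonal (fun z => y z j) * S⁻¹)
    have hTs (j : Fin N) (z : α) : T j (s z) = ((r : ℂ) • y z) j • s z := by
      simp only [T, smul_apply, hact, smul_smul, Pi.smul_apply, smul_eq_mul]
    have hTn (j : Fin N) : ‖T j‖ < 1 := by
      have h1 := (norm_conj_diagonal_le_one_iff hS fun z => y z j).2 (h j)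
      rw [norm_smul, Complex.norm_real, Real.norm_of_nonneg hr0.le]
      exact (mul_le_of_le_one_right hr0.le h1).trans_lt hr1
    have hTc (i j : Fin N) : Commute (T i) (T j) := by
      refine hext fun z => ?_
      rw [mul_apply_eq_comp, mul_apply_eq_comp, hTs, hTs, map_smul,
        map_smul, hTs, hTs, smul_comm]
    obtain ⟨A, hA, hA1⟩ := hT _ T hTn hTc
    have hAe : A = Matrix.toEuclideanCLM (n := α) (𝕜 := ℂ)
        (S * Matrix.diagonal (fun z => f ((r : ℂ) • y z)) * S⁻¹) := by
      refine hext fun z => ?_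
      rw [hact]
      have h1 := (ContinuousLinearMap.apply ℂ (EuclideanSpace ℂ α) (s z)).hasSum hA
      have h2 := (hc _ (smul_mem_polydisk (hy z) hr0.le hr1.le)).smul_const (s z)
      refine h1.unique (h2.congr_fun fun a => ?_)
      rw [ContinuousLinearMap.apply_apply, smul_apply,
        opMonomial_apply_of_eigenvector (fun j => hTs j z), smul_smul]
    rw [hAe, norm_conj_diagonal_le_one_iff hS] at hA1
    exact hA1
  have hlim (z : α) : Tendsto (fun r : ℝ => f ((r : ℂ) • y z)) (𝓝[<] 1) (𝓝 (f (y z))) := by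
    have h1 : Tendsto (fun r : ℝ => (r : ℂ) • y z) (𝓝[<] 1) (𝓝 (y z)) := by
      have : Tendsto (fun r : ℝ => (r : ℂ) • y z) (𝓝 1) (𝓝 (((1 : ℝ) : ℂ) • y z)) :=
        (Complex.continuous_ofReal.tendsto 1).smul_const _
      rw [Complex.ofReal_one, one_smul] at this
      exact this.mono_left nhdsWithin_le_nhds
    exact (hana _ (hy z)).continuousAt.tendsto.comp h1
  refine IsPSD.of_tendsto (l := 𝓝[<] (1 : ℝ)) ?_ fun z w =>
    (((hlim z).mul ((Complex.continuous_conj.tendsto _).comp (hlim w))).const_sub 1).mul_const _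
  filter_upwards [Ioo_mem_nhdsLT zero_lt_one] with r h using hr r h.1 h.2

/-- Agler's theorem on finite sets of finitely supported points. -/
theorem IsAglerInfty.hasDefectDecomposition {F : (ℕ → ℂ) → ℂ} (hF : IsAglerInfty F) [Fintype α]
    {x : ℕ → α → ℂ} (N : ℕ) (hN : ∀ j, N ≤ j → ∀ z, x j z = 0)
    (hx : ∀ z, ∃ r < 1, ∀ j, ‖x j z‖ ≤ r) :
    HasDefectDecomposition x fun z w =>
      1 - F (fun j => x j z) * conj (F fun j => x j w) := by
  classical
  refine hasDefectDecomposition_of_forall_basis hx (fun z => ?_) (fun z w => ?_)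
    fun S hS hSx => ?_
  · refine summable_of_hasFiniteSupport ((Set.finite_Iio N).subset fun j hj => ?_)
    by_contra hjN
    exact hj (by simp [hN j (not_lt.1 hjN)])
  · simp only [map_sub, map_one, map_mul, Complex.conj_conj]
    ring
  · have hext (z : α) : zeroExtend (fun i : Fin N => x i z) = fun j => x j z := by
      funext j
      by_cases hj : j < N
      · simp [zeroExtend, hj]
      · simp [zeroExtend, hj, hN j (not_lt.1 hj)]
    have h := (hF N).isPSD (y := fun z i => x i z)
      (fun z i => by obtain ⟨r, hr, h⟩ := hx z; exact (h i).trans_lt hr) hS fun j => hSx j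
    simpa [hext] using (Complex.le_def.1 (h Finset.univ fun _ => 1)).1

/-- The truncation `(z₁, …, z_m, 0, 0, …)` of a sequence. -/
def truncate (z : ℕ → ℂ) (m : ℕ) : ℕ → ℂ := fun j => if j < m then z j else 0

theorem zeroExtend_restrict (z : ℕ → ℂ) (N : ℕ) :
    zeroExtend (fun i : Fin N => z i) = truncate z N := by
  funext j
  simp [zeroExtend, truncate]

theorem norm_truncate_le (z : ℕ → ℂ) (m j : ℕ) : ‖truncate z m j‖ ≤ ‖z j‖ := by
  unfold truncate
  split_ifs <;> simp

/-- One decomposition that is valid for all truncations of the points simultaneously. -/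
theorem IsAglerInfty.exists_decomposition_truncate {F : (ℕ → ℂ) → ℂ} (hF : IsAglerInfty F)
    [Fintype α] {x : α → ℕ → ℂ} (hx : ∀ z, ∃ r < 1, ∀ j, ‖x z j‖ ≤ r) :
    ∃ K : ℕ → α × ℕ → α × ℕ → ℂ, (∀ j, IsPSD (K j)) ∧
      (∀ p q, HasSum
        (fun j => (1 - truncate (x p.1) p.2 j * conj (truncate (x q.1) q.2 j)) * K j p q)
        (1 - F (truncate (x p.1) p.2) * conj (F (truncate (x q.1) q.2)))) ∧
      ∀ p, Summable fun j => K j p p := by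
  let y : ℕ → α × ℕ → ℂ := fun j p => truncate (x p.1) p.2 j
  have hy (p : α × ℕ) : ∃ r < 1, ∀ j, ‖y j p‖ ≤ r := by
    obtain ⟨r, hr, h⟩ := hx p.1
    exact ⟨r, hr, fun j => (norm_truncate_le _ _ _).trans (h j)⟩
  have hn (n : ℕ) := hF.hasDefectDecomposition (α := α × Fin (n + 1))
    (x := fun j p => y j (p.1, p.2)) n (fun j hj p => if_neg (by lia)) fun p => hy _
  choose K P hK hP hs h using hn
  let φ (n : ℕ) (p : α × ℕ) : α × Fin (n + 1) := (p.1, ⟨min p.2 n, by lia⟩)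
  have hdec : HasDefectDecomposition y fun p q =>
      1 - F (fun j => y j p) * conj (F fun j => y j q) := by
    refine HasDefectDecomposition.of_tendsto (hyperfilter ℕ) hy (fun p => ?_)
      (K := fun n j p q => K n j (φ n p) (φ n q)) (P := fun n p q => P n (φ n p) (φ n q))
      (m := fun _ p q => 1 - F (fun j => y j p) * conj (F fun j => y j q))
      (fun n j => (hK n j).comp (φ n)) (fun n => (hP n).comp (φ n)) (fun n p => hs n (φ n p))
      (fun p q => ?_) fun p q => tendsto_const_nhds
    · refine summable_of_hasFiniteSupport ((Set.finite_Iio p.2).subset fun j hj => ?_)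
      by_contra hjN
      exact hj (by simp [y, truncate, show ¬ j < p.2 from hjN])
    · have hev : ∀ᶠ n in (hyperfilter ℕ : Filter ℕ), p.2 ≤ n ∧ q.2 ≤ n :=
        Nat.hyperfilter_le_atTop ((eventually_ge_atTop p.2).and (eventually_ge_atTop q.2))
      filter_upwards [hev] with n hn
      have h1 := h n (φ n p) (φ n q)
      simpa only [φ, min_eq_left hn.1, min_eq_left hn.2] using h1
  obtain ⟨K, hK, h, hs⟩ := hdec.exists_decomposition fun p => by
    obtain ⟨r, hr, h⟩ := hy p
    exact (h 0).trans_lt hr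
  exact ⟨K, hK, h, hs⟩

/-- Bounded families in a Hilbert space have weak limits along ultrafilters. -/
theorem exists_weak_limit {I : Type*} (u : Ultrafilter I) {H : Type*} [NormedAddCommGroup H]
    [InnerProductSpace ℂ H] [CompleteSpace H] {v : I → H} {C : ℝ} (hv : ∀ n, ‖v n‖ ≤ C) :
    ∃ v₀ : H, ∀ h, Tendsto (fun n => inner ℂ h (v n)) u (𝓝 (inner ℂ h v₀)) := by
  let g : I → WeakDual ℂ H := fun n => StrongDual.toWeakDual (InnerProductSpace.toDual ℂ H (v n))
  obtain ⟨l, -, hl⟩ := (WeakDual.isCompact_closedBall (𝕜 := ℂ) (E := H) 0 C).ultrafilter_le_nhds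
    (u.map g) (le_principal_iff.2 (mem_map.2 (univ_mem' fun n => by
      simpa [g] using hv n)))
  have hl' : Tendsto g u (𝓝 l) := hl
  refine ⟨(InnerProductSpace.toDual ℂ H).symm (WeakDual.toStrongDual l), fun h => ?_⟩
  have h1 := ((WeakDual.eval_continuous h).tendsto l).comp hl'
  have h2 := (Complex.continuous_conj.tendsto _).comp h1
  have h3 : inner ℂ ((InnerProductSpace.toDual ℂ H).symm (WeakDual.toStrongDual l)) h = l h := by
    rw [InnerProductSpace.toDual_symm_apply]
    rfl
  rw [← inner_conj_symm, h3]
  refine h2.congr fun n => ?_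
  rw [← inner_conj_symm]
  rfl

theorem IsAglerInfty.norm_truncate_le_one {F : (ℕ → ℂ) → ℂ} (hF : IsAglerInfty F) {z : ℕ → ℂ}
    (hz : ∀ j, ‖z j‖ < 1) (m : ℕ) : ‖F (truncate z m)‖ ≤ 1 := by
  have h := (hF m).1.2 (fun i => z i) fun i => hz i
  simpa only [zeroExtend_restrict] using h

/-- The Gram vectors of the kernels `Kⱼ` at the truncations of `z` have a weak limit in the
Hilbert sum over `j`, and so do their products with the coordinates. Passing to the limit in one
truncation index at a time keeps the identity between inner products, and no mass is lost. -/
theorem HasAglerExtension.hasAglerDecomposition {X : Set EllInfty} (hfin : X.Finite)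
    (hX : X ⊆ Metric.ball (0 : EllInfty) 1) {f : X → ℂ} (h : HasAglerExtension X f) :
    HasAglerDecomposition X f := by
  have := hfin.fintype
  obtain ⟨F, hF, hv⟩ := h
  have hnorm (p : X) (j : ℕ) : ‖p.1 j‖ ≤ ‖p.1‖ := lp.norm_apply_le_norm (by simp) _ _
  have hlt (p : X) : ‖p.1‖ < 1 := by simpa using hX p.2
  obtain ⟨K, hK, hM, hs⟩ := hF.exists_decomposition_truncate (x := fun (z : X) j => z.1 j)
    fun z => ⟨_, hlt z, hnorm z⟩
  choose H _ _ _ k hk using fun j => (hK j).exists_inner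
  have hksq (j : ℕ) (p : X × ℕ) : ‖k j p‖ ^ 2 = (K j p p).re := by
    rw [hk, inner_self_eq_norm_sq_to_K]
    norm_cast
  have hks (p : X × ℕ) : Summable fun j => ‖k j p‖ ^ 2 := by
    simp only [hksq]
    exact Complex.reCLM.summable (hs p)
  let y (p : X × ℕ) (j : ℕ) : ℂ := truncate (fun j => p.1.1 j) p.2 j
  have hy (p : X × ℕ) (j : ℕ) : ‖y p j‖ ≤ ‖p.1.1‖ :=
    (norm_truncate_le _ _ _).trans (hnorm _ _)
  have hmem (p : X × ℕ) (c : ℕ → ℂ) (hc : ∀ j, ‖c j‖ ≤ 1) :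
      Memℓp (fun j => c j • k j p) 2 := by
    refine memℓp_gen (Summable.of_nonneg_of_le (fun _ => by positivity) (fun j => ?_) (hks p))
    simp only [ENNReal.toReal_ofNat, Real.rpow_ofNat, norm_smul]
    gcongr
    exact mul_le_of_le_one_left (norm_nonneg _) (hc j)
  let κ (p : X × ℕ) : lp H 2 := ⟨fun j => (1 : ℂ) • k j p, hmem p (fun _ => 1) (by simp)⟩
  let δ (p : X × ℕ) : lp H 2 :=
    ⟨fun j => y p j • k j p, hmem p (y p) fun j => (hy p j).trans (hlt p.1).le⟩
  have hgram (p q : X × ℕ) : inner ℂ (κ q) (κ p) - inner ℂ (δ q) (δ p) =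
      1 - F (y p) * conj (F (y q)) := by
    have h1 : HasSum (fun j => (1 - y p j * conj (y q j)) * K j p q)
        (1 - F (y p) * conj (F (y q))) := hM p q
    have h2 := (lp.hasSum_inner (𝕜 := ℂ) (κ q) (κ p)).sub (lp.hasSum_inner (δ q) (δ p))
    refine h2.unique (h1.congr_fun fun j => ?_)
    simp only [κ, δ, one_smul, inner_smul_left, inner_smul_right, hk]
    ring
  have hF1 (p : X × ℕ) : ‖F (y p)‖ ≤ 1 :=
    hF.norm_truncate_le_one (fun j => (hnorm p.1 j).trans_lt (hlt p.1)) p.2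
  have hκ (p : X × ℕ) : ‖κ p‖ ^ 2 ≤ 2 / (1 - ‖p.1.1‖ ^ 2) := by
    have h1 : ‖1 - F (y p) * conj (F (y p))‖ ≤ 2 := by
      refine (norm_sub_le _ _).trans ?_
      rw [norm_mul, RCLike.norm_conj, norm_one]
      nlinarith [hF1 p, norm_nonneg (F (y p))]
    have h2 := (diag_le_of_hasSum (x := fun j p => y p j) hK isPSD_zero hs (hlt p.1) (hy p) h1
      (by simpa only [sub_zero] using hM p p)).2
    refine le_trans (le_of_eq ?_) h2
    have h3 := Complex.hasSum_re (lp.hasSum_inner (κ p) (κ p))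
    rw [inner_self_eq_norm_sq_to_K] at h3
    have h4 : (((‖κ p‖ : ℝ) : ℂ) ^ 2).re = ‖κ p‖ ^ 2 := by norm_cast
    refine (h4 ▸ h3.tsum_eq).symm.trans (tsum_congr fun j => ?_)
    simp only [κ, one_smul, hk]
  have hδ (p : X × ℕ) : ‖δ p‖ ≤ ‖κ p‖ := by
    refine lp.norm_mono (by simp) fun j => ?_
    simp only [κ, δ, norm_smul, norm_one]
    gcongr
    exact (hy p j).trans (hlt p.1).le
  have hκ' (p : X × ℕ) : ‖κ p‖ ≤ √(2 / (1 - ‖p.1.1‖ ^ 2)) := Real.le_sqrt_of_sq_le (hκ p)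
  let u : Ultrafilter ℕ := hyperfilter ℕ
  choose κ₀ hκ₀ using fun z : X =>
    exists_weak_limit u (v := fun n => κ (z, n))
      (C := √(2 / (1 - ‖z.1‖ ^ 2))) fun n => hκ' (z, n)
  choose δ₀ hδ₀ using fun z : X =>
    exists_weak_limit u (v := fun n => δ (z, n))
      (C := √(2 / (1 - ‖z.1‖ ^ 2))) fun n => (hδ (z, n)).trans (hκ' (z, n))
  have hlim (z : X) : Tendsto (fun n => F (y (z, n))) u (𝓝 (f z)) := by
    have h1 := (hv z).mono_left Nat.hyperfilter_le_atTop
    refine h1.congr fun n => ?_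
    rw [zeroExtend_restrict]
  have hcoord (z : X) (j : ℕ) : δ₀ z j = z.1 j • κ₀ z j := by
    refine ext_inner_left ℂ fun g => ?_
    have h1 := hδ₀ z (lp.single 2 j g)
    have h2 := (hκ₀ z (lp.single 2 j g)).const_mul (z.1 j)
    simp only [lp.inner_single_left] at h1 h2
    rw [inner_smul_right]
    refine tendsto_nhds_unique h1 (h2.congr' ?_)
    have hev : ∀ᶠ n in (u : Filter ℕ), j < n := Nat.hyperfilter_le_atTop (eventually_gt_atTop j)
    filter_upwards [hev] with n hn
    simp only [κ, δ, y, truncate, if_pos hn, one_smul, inner_smul_right]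
  have hgram₁ (z : X) (q : X × ℕ) : inner ℂ (κ q) (κ₀ z) - inner ℂ (δ q) (δ₀ z) =
      1 - f z * conj (F (y q)) := by
    refine tendsto_nhds_unique ((hκ₀ z (κ q)).sub (hδ₀ z (δ q))) ?_
    exact (((hlim z).mul_const _).const_sub 1).congr fun n => (hgram (z, n) q).symm
  have hgram₂ (z w : X) : inner ℂ (κ₀ w) (κ₀ z) - inner ℂ (δ₀ w) (δ₀ z) =
      1 - f z * conj (f w) := by
    have h1 := ((hκ₀ w (κ₀ z)).sub (hδ₀ w (δ₀ z)))
    have h2 := (Complex.continuous_conj.tendsto _).comp h1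
    have h3 : Tendsto (fun n => 1 - f z * conj (F (y (w, n)))) u (𝓝 (1 - f z * conj (f w))) :=
      (((Complex.continuous_conj.tendsto _).comp (hlim w)).const_mul _).const_sub 1
    simp only [map_sub, inner_conj_symm] at h2
    refine tendsto_nhds_unique (h2.congr fun n => ?_) h3
    simp only [Function.comp_apply, map_sub, inner_conj_symm, hgram₁]
  refine ⟨fun j z w => inner ℂ (κ₀ w j) (κ₀ z j), fun j => isPSD_inner fun z => κ₀ z j,
    fun z w => ?_, fun z => lp.summable_inner _ _⟩
  have h1 := (lp.hasSum_inner (𝕜 := ℂ) (κ₀ w) (κ₀ z)).sub (lp.hasSum_inner (δ₀ w) (δ₀ z))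
  rw [hgram₂] at h1
  refine h1.congr_fun fun j => ?_
  simp only [hcoord, inner_smul_left, inner_smul_right]
  ring

/-! ### Power series of a finite-dimensional realization -/

theorem summable_prod_pow {N : ℕ} {ρ : Fin N → ℝ} (h0 : ∀ i, 0 ≤ ρ i) (h1 : ∀ i, ρ i < 1) :
    Summable fun a : Fin N → ℕ => ∏ i, ρ i ^ a i := by
  induction N with
  | zero => exact summable_of_hasFiniteSupport (Set.toFinite _)
  | succ N ih =>
    refine (Fin.consEquiv fun _ => ℕ).summable_iff.1 ?_
    have h := (summable_geometric_of_lt_one (h0 0) (h1 0)).mul_of_nonneg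
      (ih (fun i => h0 i.succ) fun i => h1 i.succ) (fun n => pow_nonneg (h0 0) n)
      fun a => Finset.prod_nonneg fun i _ => pow_nonneg (h0 _) _
    refine h.congr fun p => ?_
    simp [Fin.prod_univ_succ, Fin.consEquiv]

section Operators

variable {N : ℕ} {H : Type} [NormedAddCommGroup H] [InnerProductSpace ℂ H]

theorem opMonomial_zero (T : Fin N → H →L[ℂ] H) : opMonomial T 0 = 1 := by
  unfold opMonomial
  simp

theorem norm_opMonomial_le (T : Fin N → H →L[ℂ] H) (a : Fin N → ℕ) :
    ‖opMonomial T a‖ ≤ ∏ i, ‖T i‖ ^ a i := by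
  have hpow (A : H →L[ℂ] H) (n : ℕ) : ‖A ^ n‖ ≤ ‖A‖ ^ n := by
    induction n with
    | zero =>
      rw [pow_zero, pow_zero]
      exact ContinuousLinearMap.norm_id_le
    | succ n ih =>
      rw [pow_succ, pow_succ]
      exact (norm_mul_le _ _).trans (by gcongr)
  unfold opMonomial
  induction N with
  | zero =>
    rw [List.ofFn_zero, List.prod_nil, Finset.univ_eq_empty, Finset.prod_empty]
    exact ContinuousLinearMap.norm_id_le
  | succ N ih =>
    rw [List.ofFn_succ, List.prod_cons, Fin.prod_univ_succ]
    refine (norm_mul_le _ _).trans ?_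
    gcongr
    · exact hpow _ _
    · exact ih (fun i => T i.succ) fun i => a i.succ

theorem opMonomial_add_single {T : Fin N → H →L[ℂ] H} (hT : ∀ i k, Commute (T i) (T k))
    (a : Fin N → ℕ) (j : Fin N) : opMonomial T (a + Pi.single j 1) = T j * opMonomial T a := by
  unfold opMonomial
  induction N with
  | zero => exact j.elim0
  | succ N ih =>
    rw [List.ofFn_succ, List.ofFn_succ, List.prod_cons, List.prod_cons]
    refine Fin.cases ?_ (fun j => ?_) j
    · simp [pow_succ', mul_assoc]
    · have h := ih (T := fun i => T i.succ) (fun i k => hT _ _) (fun i => a i.succ) j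
      have h2 : (fun i : Fin N => T i.succ ^ (a + Pi.single j.succ 1 : Fin (N + 1) → ℕ) i.succ) =
          fun i => T i.succ ^ ((fun i => a i.succ) + Pi.single j 1 : Fin N → ℕ) i := by
        funext i
        simp [Pi.single_apply]
      rw [h2, h]
      simp only [Pi.add_apply, Pi.single_apply, (Fin.succ_ne_zero j).symm, if_false, add_zero]
      rw [← mul_assoc, ← mul_assoc, ((hT 0 j.succ).pow_left _).eq]

end Operators

theorem sum_one_sub_conjTranspose_mul_inner [Fintype α] [DecidableEq α] (V : Matrix α α ℂ)
    {E : Type*} [NormedAddCommGroup E] [InnerProductSpace ℂ E] (w : α → E) :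
    ∑ z, ∑ q, ((1 : Matrix α α ℂ) z q - ∑ p, V p z * conj (V p q)) * inner ℂ (w q) (w z) =
      ((∑ q, ‖w q‖ ^ 2 - ∑ p, ‖∑ q, V p q • w q‖ ^ 2 : ℝ) : ℂ) := by
  have hsq (e : E) : ((‖e‖ ^ 2 : ℝ) : ℂ) = inner ℂ e e := by
    rw [Complex.ofReal_pow]
    exact (inner_self_eq_norm_sq_to_K (𝕜 := ℂ) e).symm
  have h1 (p : α) : ((‖∑ q, V p q • w q‖ ^ 2 : ℝ) : ℂ) =
      ∑ z, ∑ q, (V p z * conj (V p q)) * inner ℂ (w q) (w z) := by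
    rw [hsq]
    simp only [inner_sum, sum_inner, inner_smul_left, inner_smul_right, Finset.mul_sum, mul_assoc]
  have h2 (z : α) : ∑ q, (1 : Matrix α α ℂ) z q * inner ℂ (w q) (w z) = ((‖w z‖ ^ 2 : ℝ) : ℂ) := by
    rw [Finset.sum_eq_single z (fun q _ hq => by simp [Matrix.one_apply_ne hq.symm]) (by simp),
      hsq, Matrix.one_apply_eq, one_mul]
  simp only [sub_mul, Finset.sum_sub_distrib, h2, Complex.ofReal_sub, Complex.ofReal_sum]
  congr 1
  rw [Finset.sum_congr rfl fun p _ => h1 p, ← Finset.sum_comm_cycle]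
  simp only [Finset.sum_mul]

/-- A contractive matrix acts contractively on tuples of vectors of a Hilbert space. -/
theorem sum_norm_sq_mulVec_le [Fintype α] [DecidableEq α] {V : Matrix α α ℂ}
    (hV : ∀ a : α → ℂ, ∑ p, ‖V.mulVec a p‖ ^ 2 ≤ ∑ p, ‖a p‖ ^ 2) {E : Type*}
    [NormedAddCommGroup E] [InnerProductSpace ℂ E] (v : α → E) :
    ∑ p, ‖∑ q, V p q • v q‖ ^ 2 ≤ ∑ q, ‖v q‖ ^ 2 := by
  have hA : IsPSD fun z q : α => (1 : Matrix α α ℂ) z q - ∑ p, V p z * conj (V p q) := by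
    refine isPSD_of_re_nonneg (fun z w => ?_) fun a => ?_
    · simp only [map_sub, map_sum, map_mul, Complex.conj_conj, Matrix.one_apply, eq_comm (a := w),
        apply_ite conj, map_one, map_zero, mul_comm]
    · have h := congrArg Complex.re (sum_one_sub_conjTranspose_mul_inner V a)
      rw [Complex.ofReal_re] at h
      have h1 : 0 ≤ ∑ q, ‖a q‖ ^ 2 - ∑ p, ‖∑ q, V p q • a q‖ ^ 2 := sub_nonneg.2 (hV a)
      rw [← h] at h1
      refine h1.trans_eq (congrArg Complex.re ?_)
      refine Finset.sum_congr rfl fun z _ => Finset.sum_congr rfl fun q _ => ?_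
      rw [RCLike.inner_apply']
      ring
  have h := (hA.mul (isPSD_inner v)) Finset.univ fun _ => 1
  simp only [map_one, one_mul, sum_one_sub_conjTranspose_mul_inner, Complex.zero_le_real,
    sub_nonneg] at h
  exact h

/-- The coefficients, in degree `n`, of the solution `w` of the fixed point equation
`w = V (e + Δ(z) w)` as a power series in `z`. Here `V` is a matrix indexed by `Option α`, the
vector `e` is the basis vector at `none`, and `Δ(z)` is the diagonal matrix that vanishes at `none`
and has the entry `z_{τ(i)}` at `some i`. Only multi-indices of degree `n` are meaningful. -/
def realizationCoeff {N : ℕ} [Fintype α] [DecidableEq α] (V : Matrix (Option α) (Option α) ℂ)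
    (τ : α → Fin N) : ℕ → (Fin N → ℕ) → Option α → ℂ
  | 0, _ => V.mulVec (Pi.single none 1)
  | n + 1, a => V.mulVec fun q => q.elim 0 fun i =>
      if a (τ i) = 0 then 0 else realizationCoeff V τ n (a - Pi.single (τ i) 1) (some i)

section Realization

variable {N : ℕ} [Fintype α] [DecidableEq α] {V : Matrix (Option α) (Option α) ℂ} {τ : α → Fin N}

theorem sum_add_single (b : Fin N → ℕ) (t : Fin N) :
    ∑ i, (b + Pi.single t 1 : Fin N → ℕ) i = ∑ i, b i + 1 := by
  simp [Finset.sum_add_distrib]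

theorem sub_single_add_single {a : Fin N → ℕ} {t : Fin N} (ha : a t ≠ 0) :
    a - Pi.single t 1 + Pi.single t 1 = a := by
  ext i
  by_cases hi : i = t
  · subst hi
    simp
    lia
  · simp [hi]

theorem sum_finAntidiagonal_succ (t : Fin N) (n : ℕ) (φ : (Fin N → ℕ) → ℝ) :
    ∑ a ∈ Finset.finAntidiagonal N (n + 1), (if a t = 0 then 0 else φ (a - Pi.single t 1)) =
      ∑ b ∈ Finset.finAntidiagonal N n, φ b := by
  have hite (a : Fin N → ℕ) : (if a t = 0 then 0 else φ (a - Pi.single t 1)) =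
      if a t ≠ 0 then φ (a - Pi.single t 1) else 0 := by rw [ite_not]
  rw [Finset.sum_congr rfl fun a _ => hite a, ← Finset.sum_filter]
  refine Finset.sum_nbij' (fun a => a - Pi.single t 1) (fun b => b + Pi.single t 1)
    (fun a ha => ?_) (fun b hb => ?_) (fun a ha => ?_) (fun b _ => ?_) fun a _ => rfl
  · rw [Finset.mem_filter, Finset.mem_finAntidiagonal] at ha
    rw [Finset.mem_finAntidiagonal]
    have h := sum_add_single (a - Pi.single t 1) t
    rw [sub_single_add_single ha.2] at h
    lia
  · rw [Finset.mem_finAntidiagonal] at hb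
    rw [Finset.mem_filter, Finset.mem_finAntidiagonal, sum_add_single, hb]
    simp
  · exact sub_single_add_single (Finset.mem_filter.1 ha).2
  · exact add_tsub_cancel_right _ _

/-- The homogeneous coefficients satisfy `∑_{|a| = n} ‖w_a‖² ≤ 1`: the summands of
`w_a = V ∑ⱼ Pⱼ w_{a - eⱼ}` are orthogonal and `V` is a contraction. -/
theorem sum_realizationCoeff_le
    (hV : ∀ a : Option α → ℂ, ∑ p, ‖V.mulVec a p‖ ^ 2 ≤ ∑ p, ‖a p‖ ^ 2) (n : ℕ) :
    ∑ a ∈ Finset.finAntidiagonal N n, ∑ p, ‖realizationCoeff V τ n a p‖ ^ 2 ≤ 1 := by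
  induction n with
  | zero =>
    have h0 : Finset.finAntidiagonal N 0 = {(0 : Fin N → ℕ)} := by
      ext a
      simp [Finset.mem_finAntidiagonal, funext_iff]
    rw [h0, Finset.sum_singleton]
    refine (hV _).trans ?_
    simp [Fintype.sum_option]
  | succ n ih =>
    refine le_trans ?_ ih
    calc ∑ a ∈ Finset.finAntidiagonal N (n + 1), ∑ p, ‖realizationCoeff V τ (n + 1) a p‖ ^ 2
        ≤ ∑ a ∈ Finset.finAntidiagonal N (n + 1), ∑ i, (if a (τ i) = 0 then 0 else
            ‖realizationCoeff V τ n (a - Pi.single (τ i) 1) (some i)‖ ^ 2) := by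
          refine Finset.sum_le_sum fun a _ => (hV _).trans_eq ?_
          rw [Fintype.sum_option]
          simp only [Option.elim_none, Option.elim_some, norm_zero]
          rw [zero_pow two_ne_zero, zero_add]
          refine Finset.sum_congr rfl fun i _ => ?_
          split_ifs <;> simp
      _ = ∑ i, ∑ b ∈ Finset.finAntidiagonal N n, ‖realizationCoeff V τ n b (some i)‖ ^ 2 := by
          rw [Finset.sum_comm]
          exact Finset.sum_congr rfl fun i _ => sum_finAntidiagonal_succ (τ i) n
            fun b => ‖realizationCoeff V τ n b (some i)‖ ^ 2
      _ ≤ _ := by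
          rw [Finset.sum_comm]
          refine Finset.sum_le_sum fun b _ => ?_
          rw [Fintype.sum_option]
          exact le_add_of_nonneg_left (by positivity)

theorem norm_realizationCoeff_le
    (hV : ∀ a : Option α → ℂ, ∑ p, ‖V.mulVec a p‖ ^ 2 ≤ ∑ p, ‖a p‖ ^ 2) (a : Fin N → ℕ)
    (p : Option α) : ‖realizationCoeff V τ (∑ i, a i) a p‖ ≤ 1 := by
  have h := sum_realizationCoeff_le (τ := τ) hV (∑ i, a i)
  have h1 := Finset.single_le_sum (f := fun b => ∑ p, ‖realizationCoeff V τ (∑ i, a i) b p‖ ^ 2)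
    (fun b _ => by positivity) (Finset.mem_finAntidiagonal.2 (rfl : ∑ i, a i = ∑ i, a i))
  have h2 := Finset.single_le_sum (f := fun p => ‖realizationCoeff V τ (∑ i, a i) a p‖ ^ 2)
    (fun b _ => by positivity) (Finset.mem_univ p)
  have h3 := h2.trans (h1.trans h)
  exact (sq_le_one_iff₀ (norm_nonneg _)).1 h3

theorem realizationCoeff_eq_mulVec (a : Fin N → ℕ) :
    realizationCoeff V τ (∑ i, a i) a = V.mulVec fun q => q.elim (if a = 0 then 1 else 0) fun i =>
      if a (τ i) = 0 then 0 else
        realizationCoeff V τ (∑ k, (a - Pi.single (τ i) 1 : Fin N → ℕ) k) (a - Pi.single (τ i) 1) (some i) := by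
  rcases eq_or_ne a 0 with rfl | ha
  · simp only [Pi.zero_apply, Finset.sum_const_zero, realizationCoeff, if_true]
    congr 1
    funext q
    cases q <;> simp
  · obtain ⟨n, hn⟩ : ∃ n, ∑ i, a i = n + 1 := by
      refine Nat.exists_eq_succ_of_ne_zero fun h => ha (funext fun i => ?_)
      simpa using (Finset.sum_eq_zero_iff.1 h) i (Finset.mem_univ i)
    rw [hn]
    simp only [realizationCoeff, if_neg ha]
    congr 1
    funext q
    cases q with
    | none => rfl
    | some i =>
      simp only [Option.elim_some]
      split_ifs with h0
      · rfl
      · have hsum : ∑ k, (a - Pi.single (τ i) 1 : Fin N → ℕ) k = n := by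
          have h := sum_add_single (a - Pi.single (τ i) 1) (τ i)
          rw [sub_single_add_single h0, hn] at h
          lia
        rw [hsum]

/-- Substitution of commuting strict contractions into the power series `w`: the series
converge, and the operators `Wₚ` solve the fixed point equation. -/
theorem exists_hasSum_realizationCoeff
    (hV : ∀ a : Option α → ℂ, ∑ p, ‖V.mulVec a p‖ ^ 2 ≤ ∑ p, ‖a p‖ ^ 2) {H : Type}
    [NormedAddCommGroup H] [InnerProductSpace ℂ H] [CompleteSpace H] {T : Fin N → H →L[ℂ] H}
    (hT : ∀ i, ‖T i‖ < 1) (hc : ∀ i k, Commute (T i) (T k)) :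
    ∃ W : Option α → H →L[ℂ] H,
      (∀ p, HasSum (fun a => realizationCoeff V τ (∑ i, a i) a p • opMonomial T a) (W p)) ∧
      ∀ p, W p = ∑ q, V p q • q.elim 1 fun i => T (τ i) * W (some i) := by
  have hs (p : Option α) :
      Summable fun a => realizationCoeff V τ (∑ i, a i) a p • opMonomial T a := by
    refine Summable.of_norm_bounded (summable_prod_pow (fun i => norm_nonneg (T i)) hT) fun a => ?_
    rw [norm_smul]
    exact (mul_le_of_le_one_left (norm_nonneg _) (norm_realizationCoeff_le hV a p)).trans
      (norm_opMonomial_le T a)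
  refine ⟨fun p => ∑' a, realizationCoeff V τ (∑ i, a i) a p • opMonomial T a,
    fun p => (hs p).hasSum, fun p => ?_⟩
  have hin (q : Option α) : HasSum (fun a : Fin N → ℕ =>
      (q.elim (if a = 0 then (1 : ℂ) else 0) fun i => if a (τ i) = 0 then 0 else
        realizationCoeff V τ (∑ k, (a - Pi.single (τ i) 1 : Fin N → ℕ) k) (a - Pi.single (τ i) 1) (some i)) •
      opMonomial T a) (q.elim 1 fun i =>
        T (τ i) * ∑' a, realizationCoeff V τ (∑ i, a i) a (some i) • opMonomial T a) := by
    cases q with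
    | none =>
      have h := hasSum_single (f := fun a : Fin N → ℕ =>
        (if a = 0 then (1 : ℂ) else 0) • opMonomial T a) 0 fun a ha => by simp [ha]
      simpa [opMonomial_zero] using h
    | some i =>
      simp only [Option.elim_some]
      have h := (hs (some i)).hasSum.mul_left (T (τ i))
      have hinj : Function.Injective fun b : Fin N → ℕ => b + Pi.single (τ i) 1 :=
        add_left_injective _
      refine (hinj.hasSum_iff fun a ha => ?_).1 (h.congr_fun fun b => ?_)
      · rw [if_pos, zero_smul]
        by_contra h0
        exact ha ⟨a - Pi.single (τ i) 1, sub_single_add_single h0⟩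
      · have hne : (b + Pi.single (τ i) 1 : Fin N → ℕ) (τ i) ≠ 0 := by simp
        simp only [Function.comp_apply, if_neg hne, add_tsub_cancel_right,
          opMonomial_add_single hc, mul_smul_comm]
  refine (hs p).hasSum.unique ((hasSum_sum fun q _ => (hin q).const_smul (V p q)).congr_fun ?_)
  intro a
  rw [realizationCoeff_eq_mulVec]
  simp only [Matrix.mulVec, dotProduct, Finset.sum_smul, mul_smul]

end Realization

/-! ### Finite-dimensional realizations belong to the Agler class -/

theorem eq_zero_of_fixed_point {N : ℕ} [Fintype α] {V : Matrix (Option α) (Option α) ℂ}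
    {τ : α → Fin N} (hV : ∀ a : Option α → ℂ, ∑ p, ‖V.mulVec a p‖ ^ 2 ≤ ∑ p, ‖a p‖ ^ 2) {z : Fin N → ℂ}
    (hz : z ∈ polydisk N) {d : Option α → ℂ}
    (hd : V.mulVec (fun q => q.elim 0 fun i => z (τ i) * d (some i)) = d) : d = 0 := by
  have h := hV fun q => q.elim 0 fun i => z (τ i) * d (some i)
  rw [hd, Fintype.sum_option, Fintype.sum_option] at h
  simp only [Option.elim_none, Option.elim_some, norm_zero, norm_mul, mul_pow] at h
  have hpos (i : α) : 0 < 1 - ‖z (τ i)‖ ^ 2 := by nlinarith [hz (τ i), norm_nonneg (z (τ i))]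
  have h1 : ‖d none‖ ^ 2 + ∑ i, (1 - ‖z (τ i)‖ ^ 2) * ‖d (some i)‖ ^ 2 ≤ 0 := by
    simp only [sub_mul, one_mul, Finset.sum_sub_distrib]
    linarith
  have h2 : 0 ≤ ∑ i, (1 - ‖z (τ i)‖ ^ 2) * ‖d (some i)‖ ^ 2 :=
    Finset.sum_nonneg fun i _ => mul_nonneg (hpos i).le (sq_nonneg _)
  have h3 : ∑ i, (1 - ‖z (τ i)‖ ^ 2) * ‖d (some i)‖ ^ 2 = 0 := by
    nlinarith [sq_nonneg ‖d none‖]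
  funext p
  cases p with
  | none =>
    have : ‖d none‖ ^ 2 = 0 := by nlinarith [sq_nonneg ‖d none‖]
    simpa using this
  | some i =>
    have h4 := (Finset.sum_eq_zero_iff_of_nonneg fun i _ =>
      mul_nonneg (hpos i).le (sq_nonneg ‖d (some i)‖)).1 h3 i (Finset.mem_univ i)
    simpa [(hpos i).ne'] using h4

section Realization

variable {N : ℕ} [Fintype α] [DecidableEq α] {V : Matrix (Option α) (Option α) ℂ} {τ : α → Fin N}

/-- The matrix `1 - V Δ(z)` of the fixed point equation. -/
def realizationMatrix (V : Matrix (Option α) (Option α) ℂ) (τ : α → Fin N) (z : Fin N → ℂ) :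
    Matrix (Option α) (Option α) ℂ :=
  1 - V * Matrix.diagonal fun q => q.elim 0 fun i => z (τ i)

theorem realizationMatrix_mulVec (z : Fin N → ℂ) (y : Option α → ℂ) :
    (realizationMatrix V τ z).mulVec y =
      y - V.mulVec fun q => q.elim 0 fun i => z (τ i) * y (some i) := by
  rw [realizationMatrix, Matrix.sub_mulVec, Matrix.one_mulVec, ← Matrix.mulVec_mulVec]
  congr 2
  funext q
  rw [Matrix.mulVec_diagonal]
  cases q <;> simp

theorem det_realizationMatrix_ne_zero
    (hV : ∀ a : Option α → ℂ, ∑ p, ‖V.mulVec a p‖ ^ 2 ≤ ∑ p, ‖a p‖ ^ 2) {z : Fin N → ℂ}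
    (hz : z ∈ polydisk N) : (realizationMatrix V τ z).det ≠ 0 := by
  intro h
  obtain ⟨d, hd0, hd⟩ := Matrix.exists_mulVec_eq_zero_iff.2 h
  rw [realizationMatrix_mulVec, sub_eq_zero] at hd
  exact hd0 (eq_zero_of_fixed_point hV hz hd.symm)

theorem fixed_point_iff (z : Fin N → ℂ) (y : Option α → ℂ) :
    (∀ p, y p = ∑ q, V p q * q.elim 1 fun i => z (τ i) * y (some i)) ↔
      (realizationMatrix V τ z).mulVec y = V.mulVec (Pi.single none 1) := by
  rw [realizationMatrix_mulVec, sub_eq_iff_eq_add, ← Matrix.mulVec_add, funext_iff]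
  refine forall_congr' fun p => Eq.congr_right ?_
  refine Finset.sum_congr rfl fun q _ => ?_
  cases q <;> simp

theorem exists_fixed_point
    (hV : ∀ a : Option α → ℂ, ∑ p, ‖V.mulVec a p‖ ^ 2 ≤ ∑ p, ‖a p‖ ^ 2) {z : Fin N → ℂ}
    (hz : z ∈ polydisk N) :
    ∃ y : Option α → ℂ, ∀ p, y p = ∑ q, V p q * q.elim 1 fun i => z (τ i) * y (some i) := by
  refine ⟨(realizationMatrix V τ z)⁻¹.mulVec (V.mulVec (Pi.single none 1)),
    (fixed_point_iff z _).2 ?_⟩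
  rw [Matrix.mulVec_mulVec, Matrix.mul_nonsing_inv _ (det_realizationMatrix_ne_zero hV hz).isUnit,
    Matrix.one_mulVec]

theorem analyticAt_det {E : Type*} [NormedAddCommGroup E] [NormedSpace ℂ E] [Fintype β]
    [DecidableEq β] {A : E → Matrix β β ℂ} {z : E}
    (hA : ∀ i j, AnalyticAt ℂ (fun z => A z i j) z) : AnalyticAt ℂ (fun z => (A z).det) z := by
  simp only [Matrix.det_apply']
  exact Finset.analyticAt_fun_sum _ fun σ _ =>
    analyticAt_const.mul (Finset.analyticAt_fun_prod _ fun i _ => hA _ _)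

theorem analyticAt_realizationMatrix (p q : Option α) (z : Fin N → ℂ) :
    AnalyticAt ℂ (fun z => realizationMatrix V τ z p q) z := by
  simp only [realizationMatrix, Matrix.sub_apply, Matrix.mul_diagonal]
  refine analyticAt_const.sub (analyticAt_const.mul ?_)
  cases q with
  | none => exact analyticAt_const
  | some i => exact (ContinuousLinearMap.proj (R := ℂ) (φ := fun _ : Fin N => ℂ) (τ i)).analyticAt z

/-- A function with a finite-dimensional contractive realization
`f(z) = ⟨(1 - V Δ(z))⁻¹ V e, e⟩` belongs to the Agler class. -/
theorem isAgler_of_realization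
    (hV : ∀ a : Option α → ℂ, ∑ p, ‖V.mulVec a p‖ ^ 2 ≤ ∑ p, ‖a p‖ ^ 2) {f : (Fin N → ℂ) → ℂ}
    (hf : ∀ z ∈ polydisk N, ∃ y : Option α → ℂ, f z = y none ∧
      ∀ p, y p = ∑ q, V p q * q.elim 1 fun i => z (τ i) * y (some i)) : IsAgler f := by
  have hop (H : Type) [NormedAddCommGroup H] [InnerProductSpace ℂ H] [CompleteSpace H]
      (T : Fin N → H →L[ℂ] H) (hT : ∀ i, ‖T i‖ < 1) {W : Option α → H →L[ℂ] H}
      (hW : ∀ p, W p = ∑ q, V p q • q.elim 1 fun i => T (τ i) * W (some i)) : ‖W none‖ ≤ 1 := by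
    refine ContinuousLinearMap.opNorm_le_bound _ zero_le_one fun h => ?_
    have h1 := sum_norm_sq_mulVec_le hV fun q : Option α =>
      (q.elim 1 fun i => T (τ i) * W (some i) : H →L[ℂ] H) h
    have h2 (p : Option α) : ∑ q, V p q • (q.elim 1 fun i => T (τ i) * W (some i) : H →L[ℂ] H) h =
        W p h := by
      conv_rhs => rw [hW p]
      simp
    simp only [h2] at h1
    rw [Fintype.sum_option, Fintype.sum_option] at h1
    simp only [Option.elim_none, Option.elim_some, one_apply_eq_self, mul_apply_eq_comp] at h1
    have h3 : ∑ i, ‖T (τ i) (W (some i) h)‖ ^ 2 ≤ ∑ i, ‖W (some i) h‖ ^ 2 := by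
      refine Finset.sum_le_sum fun i _ => ?_
      gcongr
      exact ((T (τ i)).le_of_opNorm_le (hT _).le _).trans_eq (one_mul _)
    rw [one_mul]
    exact (pow_le_pow_iff_left₀ (norm_nonneg _) (norm_nonneg _) two_ne_zero).1 (by linarith)
  have hscalar (z : Fin N → ℂ) (hz : z ∈ polydisk N) :
      HasSum (fun a => realizationCoeff V τ (∑ i, a i) a none * ∏ i, z i ^ a i) (f z) ∧
        ‖f z‖ ≤ 1 := by
    let T : Fin N → ℂ →L[ℂ] ℂ := fun i => z i • 1
    have hT (i : Fin N) : ‖T i‖ < 1 := by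
      simpa [T, norm_smul] using hz i
    have hTe (i : Fin N) : T i 1 = z i • (1 : ℂ) := by simp [T]
    obtain ⟨W, hW, hWe⟩ := exists_hasSum_realizationCoeff (τ := τ) hV hT fun i k => by
      simp only [T]
      exact ((Commute.one_left _).smul_left _)
    obtain ⟨y, hy, hye⟩ := hf z hz
    have hWy (p : Option α) : W p 1 = ∑ q, V p q * q.elim 1 fun i => z (τ i) * W (some i) 1 := by
      conv_lhs => rw [hWe p]
      rw [sum_apply]
      refine Finset.sum_congr rfl fun q _ => ?_
      cases q <;> simp [T]
    have huniq : (fun p => W p 1) = y := by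
      have hinj := Matrix.mulVec_injective_iff_isUnit.2 ((Matrix.isUnit_iff_isUnit_det _).2
        (det_realizationMatrix_ne_zero (τ := τ) hV hz).isUnit)
      exact hinj (((fixed_point_iff z _).1 hWy).trans ((fixed_point_iff z _).1 hye).symm)
    have hfW : f z = W none 1 := by rw [hy, ← huniq]
    rw [hfW]
    constructor
    · refine ((ContinuousLinearMap.apply ℂ ℂ (1 : ℂ)).hasSum (hW none)).congr_fun fun a => ?_
      simp [opMonomial_apply_of_eigenvector hTe]
    · have := (W none).le_of_opNorm_le (hop ℂ T hT hWe) 1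
      simpa using this
  refine ⟨⟨fun z hz => ?_, fun z hz => (hscalar z hz).2⟩, fun a =>
    realizationCoeff V τ (∑ i, a i) a none, fun z hz => (hscalar z hz).1, ?_⟩
  · have hopen : IsOpen (polydisk N) := by
      simp only [polydisk, Set.ofPred_forall]
      exact isOpen_iInter_of_finite fun i => isOpen_lt (continuous_apply i).norm continuous_const
    -- Cramer's rule expresses the function as a quotient of determinants.
    have hquot : ∀ᶠ w in 𝓝 z, ((realizationMatrix V τ w).updateCol none
        (V.mulVec (Pi.single none 1))).det / (realizationMatrix V τ w).det = f w := by
      filter_upwards [hopen.mem_nhds hz] with w hw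
      obtain ⟨y, hy, hye⟩ := hf w hw
      rw [div_eq_iff (det_realizationMatrix_ne_zero hV hw), ← Matrix.cramer_apply,
        ← (fixed_point_iff w y).1 hye, Matrix.cramer_eq_adjugate_mulVec, Matrix.mulVec_mulVec,
        Matrix.adjugate_mul, Matrix.smul_mulVec, Matrix.one_mulVec, hy, Pi.smul_apply,
        smul_eq_mul, mul_comm]
    refine AnalyticAt.congr ?_ hquot
    refine (analyticAt_det fun p q => ?_).div
      (analyticAt_det fun p q => analyticAt_realizationMatrix p q z)
      (det_realizationMatrix_ne_zero hV hz)
    by_cases hq : q = none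
    · subst hq
      simpa using analyticAt_const
    · simpa [Matrix.updateCol_ne hq] using analyticAt_realizationMatrix p q z
  · intro H _ _ _ T hT hc
    obtain ⟨W, hW, hWe⟩ := exists_hasSum_realizationCoeff (τ := τ) hV hT hc
    exact ⟨W none, hW none, hop H T hT hWe⟩

end Realization

/-! ### Transfer functions of contractions on `ℓ²` -/

/-- Two finite families with equal Gram matrices are related by a contraction, namely the partial
isometry between their spans. -/
theorem exists_contraction_of_inner_eq [Finite α] {H : Type*} [NormedAddCommGroup H]
    [InnerProductSpace ℂ H] [CompleteSpace H] {u v : α → H}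
    (h : ∀ z w, inner ℂ (u w) (u z) = inner ℂ (v w) (v z)) :
    ∃ V : H →L[ℂ] H, ‖V‖ ≤ 1 ∧ ∀ z, V (u z) = v z := by
  classical
  have := Fintype.ofFinite α
  let L : (α → ℂ) →ₗ[ℂ] H := Fintype.linearCombination ℂ u
  let R : (α → ℂ) →ₗ[ℂ] H := Fintype.linearCombination ℂ v
  have hnorm (a : α → ℂ) : ‖R a‖ = ‖L a‖ := by
    have h1 : inner ℂ (R a) (R a) = inner ℂ (L a) (L a) := by
      simp only [L, R, Fintype.linearCombination_apply, inner_sum, sum_inner, inner_smul_left,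
        inner_smul_right, h]
    rw [norm_eq_sqrt_re_inner (𝕜 := ℂ), norm_eq_sqrt_re_inner (𝕜 := ℂ), h1]
  obtain ⟨g, hg⟩ := L.rangeRestrict.exists_rightInverse_of_surjective L.range_rangeRestrict
  have hLg (y : LinearMap.range L) : L (g y) = y := congrArg Subtype.val (LinearMap.congr_fun hg y)
  let V₀ : LinearMap.range L →L[ℂ] H := (R ∘ₗ g).mkContinuous 1 fun y => by
    rw [one_mul, LinearMap.comp_apply, hnorm, hLg]
    rfl
  refine ⟨V₀ ∘L (LinearMap.range L).orthogonalProjectionOnto, ?_, fun z => ?_⟩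
  · refine (ContinuousLinearMap.opNorm_comp_le _ _).trans (mul_le_one₀ ?_ (norm_nonneg _) ?_)
    · exact LinearMap.mkContinuous_norm_le _ zero_le_one _
    · exact Submodule.orthogonalProjectionOnto_norm_le _
  · have hu : u z = L (Pi.single z 1) := by simp [L, Fintype.linearCombination_apply_single]
    have hv : v z = R (Pi.single z 1) := by simp [R, Fintype.linearCombination_apply_single]
    have hmem : u z ∈ LinearMap.range L := ⟨_, hu.symm⟩
    rw [ContinuousLinearMap.comp_apply]
    have hproj : (LinearMap.range L).orthogonalProjectionOnto (u z) = ⟨u z, hmem⟩ :=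
      Submodule.orthogonalProjectionOnto_mem_subspace_eq_self (⟨u z, hmem⟩ : LinearMap.range L)
    rw [hproj]
    change R (g ⟨u z, hmem⟩) = v z
    rw [hv, ← sub_eq_zero, ← map_sub, ← norm_eq_zero, hnorm, map_sub, hLg, ← hu, sub_self,
      norm_zero]

theorem hasSum_option {E : Type*} [AddCommGroup E] [TopologicalSpace E] [ContinuousAdd E]
    {f : Option β → E} {a : E} (h : HasSum (fun b => f (some b)) a) :
    HasSum f (f none + a) := by
  classical
  have h1 : HasSum (fun q : Option β => if q = none then f none else 0) (f none) :=
    hasSum_ite_eq none (f none)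
  have h2 : HasSum (fun q : Option β => q.elim 0 fun b => f (some b)) a := by
    refine ((Option.some_injective β).hasSum_iff fun q hq => ?_).1 h
    cases q with
    | none => rfl
    | some b => exact absurd ⟨b, rfl⟩ hq
  refine (h1.add h2).congr_fun fun q => ?_
  cases q <;> simp

/-- The Hilbert space `ℓ²(Ω)`. -/
abbrev EllTwo (Ω : Type) : Type := lp (fun _ : Ω => ℂ) 2

/-- The value at `x` of the transfer function of `V`: the coordinate at `none` of the solution `w`
of `w = V (e + Δ(x) w)`, where `e` is the basis vector at `none` and `Δ(x)` multiplies the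
coordinates `(j, i)` by `xⱼ` and annihilates the coordinate `none`. It is `0` where no solution
exists. -/
noncomputable def transferFunction (V : EllTwo (Option (ℕ × α)) →L[ℂ] EllTwo (Option (ℕ × α)))
    (x : ℕ → ℂ) : ℂ :=
  open scoped Classical in
  if h : ∃ w s : EllTwo (Option (ℕ × α)),
      s none = 1 ∧ (∀ p : ℕ × α, s (some p) = x p.1 * w (some p)) ∧ w = V s
  then h.choose none else 0

theorem transferFunction_spec {V : EllTwo (Option (ℕ × α)) →L[ℂ] EllTwo (Option (ℕ × α))}
    {x : ℕ → ℂ} (h : ∃ w s : EllTwo (Option (ℕ × α)),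
      s none = 1 ∧ (∀ p : ℕ × α, s (some p) = x p.1 * w (some p)) ∧ w = V s) :
    ∃ w s : EllTwo (Option (ℕ × α)), s none = 1 ∧
      (∀ p : ℕ × α, s (some p) = x p.1 * w (some p)) ∧ w = V s ∧ transferFunction V x = w none := by
  obtain ⟨s, h1, h2, h3⟩ := h.choose_spec
  exact ⟨h.choose, s, h1, h2, h3, dif_pos h⟩

/-- The inclusion of the coordinates with `j < N`. -/
def sectionIndex (N : ℕ) : Option (Fin N × α) → Option (ℕ × α) :=
  Option.map (Prod.map Fin.val id)

theorem sectionIndex_injective (N : ℕ) : Function.Injective (sectionIndex (α := α) N) :=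
  Option.map_injective (Fin.val_injective.prodMap Function.injective_id)

theorem some_mem_range_sectionIndex {N : ℕ} {p : ℕ × α} :
    some p ∈ Set.range (sectionIndex (α := α) N) ↔ p.1 < N := by
  constructor
  · rintro ⟨_ | i, hi⟩
    · exact absurd hi (by simp [sectionIndex])
    · have := congrArg (Option.map Prod.fst) hi
      simp only [sectionIndex, Option.map_some, Prod.map_fst, Option.some.injEq] at this
      exact this ▸ i.1.2
  · intro hp
    exact ⟨some (⟨p.1, hp⟩, p.2), rfl⟩

section FiniteSections

variable [Fintype α] [DecidableEq α]

/-- The compression of `V` to the coordinates with `j < N`. -/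
noncomputable def finiteSection (V : EllTwo (Option (ℕ × α)) →L[ℂ] EllTwo (Option (ℕ × α)))
    (N : ℕ) : Matrix (Option (Fin N × α)) (Option (Fin N × α)) ℂ :=
  Matrix.of fun p q => V (lp.single 2 (sectionIndex N q) 1) (sectionIndex N p)

theorem apply_sum_single (V : EllTwo (Option (ℕ × α)) →L[ℂ] EllTwo (Option (ℕ × α))) (N : ℕ)
    (a : Option (Fin N × α) → ℂ) (p : Option (Fin N × α)) :
    V (∑ q, lp.single 2 (sectionIndex N q) (a q)) (sectionIndex N p) =
      ∑ q, finiteSection V N p q * a q := by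
  have h (q : Option (Fin N × α)) : (lp.single 2 (sectionIndex N q) (a q) :
      EllTwo (Option (ℕ × α))) = a q • lp.single 2 (sectionIndex N q) 1 := by
    rw [← lp.single_smul, smul_eq_mul, mul_one]
  simp only [h, map_sum, map_smul, lp.coeFn_sum, Finset.sum_apply, lp.coeFn_smul, Pi.smul_apply,
    smul_eq_mul, finiteSection, Matrix.of_apply, mul_comm]

theorem sum_single_apply_sectionIndex (N : ℕ) (a : Option (Fin N × α) → ℂ)
    (p : Option (Fin N × α)) :
    (∑ q, lp.single 2 (sectionIndex N q) (a q) : EllTwo (Option (ℕ × α))) (sectionIndex N p) =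
      a p := by
  rw [lp.coeFn_sum, Finset.sum_apply, Finset.sum_eq_single p]
  · rw [lp.single_apply_self]
  · intro r _ hr
    exact lp.single_apply_ne _ _ _ fun h => hr (sectionIndex_injective N h.symm)
  · simp

theorem sum_single_apply_of_notMem (N : ℕ) (a : Option (Fin N × α) → ℂ) {ω : Option (ℕ × α)}
    (hω : ω ∉ Set.range (sectionIndex (α := α) N)) :
    (∑ q, lp.single 2 (sectionIndex N q) (a q) : EllTwo (Option (ℕ × α))) ω = 0 := by
  rw [lp.coeFn_sum, Finset.sum_apply]
  exact Finset.sum_eq_zero fun q _ => lp.single_apply_ne _ _ _ fun h => hω ⟨q, h.symm⟩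

theorem norm_sq_sum_single (N : ℕ) (a : Option (Fin N × α) → ℂ) :
    ‖(∑ q, lp.single 2 (sectionIndex N q) (a q) : EllTwo (Option (ℕ × α)))‖ ^ 2 =
      ∑ q, ‖a q‖ ^ 2 := by
  have h := lp.hasSum_norm (by simp)
    (∑ q, lp.single 2 (sectionIndex N q) (a q) : EllTwo (Option (ℕ × α)))
  simp only [ENNReal.toReal_ofNat, Real.rpow_ofNat] at h
  rw [← (sectionIndex_injective N).hasSum_iff fun ω hω => by
    rw [sum_single_apply_of_notMem N a hω, norm_zero, zero_pow two_ne_zero]] at h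
  refine h.unique ((hasSum_fintype _).congr_fun fun p => ?_)
  simp only [Function.comp_apply, sum_single_apply_sectionIndex]

theorem finiteSection_contraction {V : EllTwo (Option (ℕ × α)) →L[ℂ] EllTwo (Option (ℕ × α))}
    (hV : ‖V‖ ≤ 1) (N : ℕ) (a : Option (Fin N × α) → ℂ) :
    ∑ p, ‖(finiteSection V N).mulVec a p‖ ^ 2 ≤ ∑ p, ‖a p‖ ^ 2 := by
  rw [← norm_sq_sum_single N a]
  set s : EllTwo (Option (ℕ × α)) := ∑ q, lp.single 2 (sectionIndex N q) (a q) with hs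
  have h1 := lp.sum_rpow_le_norm_rpow (by simp) (V s)
    (Finset.univ.map ⟨sectionIndex N, sectionIndex_injective N⟩)
  simp only [ENNReal.toReal_ofNat, Real.rpow_ofNat, Finset.sum_map,
    Function.Embedding.coeFn_mk] at h1
  have h2 : ‖V s‖ ≤ ‖s‖ := (V.le_of_opNorm_le hV s).trans_eq (one_mul _)
  refine (Finset.sum_le_sum fun p _ => le_of_eq ?_).trans (h1.trans (by gcongr))
  rw [hs, apply_sum_single]
  rfl

theorem zeroExtend_coe {N : ℕ} (z : Fin N → ℂ) (j : Fin N) : zeroExtend z j = z j := by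
  simp [zeroExtend]

theorem exists_solution_zeroExtend {V : EllTwo (Option (ℕ × α)) →L[ℂ] EllTwo (Option (ℕ × α))}
    (hV : ‖V‖ ≤ 1) {N : ℕ} {z : Fin N → ℂ} (hz : z ∈ polydisk N) :
    ∃ w s : EllTwo (Option (ℕ × α)), s none = 1 ∧
      (∀ p : ℕ × α, s (some p) = zeroExtend z p.1 * w (some p)) ∧ w = V s := by
  obtain ⟨y, hy⟩ := exists_fixed_point (τ := Prod.fst) (finiteSection_contraction hV N) hz
  let a : Option (Fin N × α) → ℂ := fun q => q.elim 1 fun i => z i.1 * y (some i)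
  have hsa := sum_single_apply_sectionIndex (α := α) N a
  refine ⟨_, ∑ q, lp.single 2 (sectionIndex N q) (a q), hsa none, fun p => ?_, rfl⟩
  by_cases hp : p.1 < N
  · have h1 := hsa (some (⟨p.1, hp⟩, p.2))
    have h2 := apply_sum_single V N a (some (⟨p.1, hp⟩, p.2))
    have hp' : sectionIndex N (some (⟨p.1, hp⟩, p.2)) = some p := rfl
    rw [hp'] at h1 h2
    rw [h1, h2, ← hy]
    simp [a, zeroExtend, hp]
  · rw [sum_single_apply_of_notMem N a (some_mem_range_sectionIndex.not.2 hp),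
      show zeroExtend z p.1 = 0 by simp [zeroExtend, hp], zero_mul]

/-- The transfer function of a contraction belongs to the Agler class: its restriction to `𝔻^N` is
the transfer function of the `N`-th finite section. -/
theorem isAglerInfty_transferFunction
    {V : EllTwo (Option (ℕ × α)) →L[ℂ] EllTwo (Option (ℕ × α))} (hV : ‖V‖ ≤ 1) :
    IsAglerInfty (transferFunction V) := by
  intro N
  refine isAgler_of_realization (τ := Prod.fst) (finiteSection_contraction hV N) fun z hz => ?_
  obtain ⟨w, s, hs0, hs, hw, hF⟩ := transferFunction_spec (exists_solution_zeroExtend hV hz)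
  refine ⟨fun p => w (sectionIndex N p), hF, fun p => ?_⟩
  let a : Option (Fin N × α) → ℂ := fun q => q.elim 1 fun i => z i.1 * w (sectionIndex N (some i))
  have hsum : s = ∑ q, lp.single 2 (sectionIndex N q) (a q) := by
    refine lp.ext (funext fun ω => ?_)
    by_cases hω : ω ∈ Set.range (sectionIndex (α := α) N)
    · obtain ⟨q, rfl⟩ := hω
      rw [sum_single_apply_sectionIndex]
      cases q with
      | none => exact hs0
      | some i => exact (hs (i.1, i.2)).trans (by rw [zeroExtend_coe]; rfl)
    · rw [sum_single_apply_of_notMem N a hω]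
      cases ω with
      | none => exact absurd ⟨none, rfl⟩ hω
      | some p =>
        rw [some_mem_range_sectionIndex] at hω
        rw [hs, show zeroExtend z p.1 = 0 by simp [zeroExtend, hω], zero_mul]
  have h := apply_sum_single V N a p
  rwa [← hsum, ← hw] at h

/-- Convergence of the transfer function along truncations of a point of the ball. -/
theorem tendsto_transferFunction {V : EllTwo (Option (ℕ × α)) →L[ℂ] EllTwo (Option (ℕ × α))}
    (hV : ‖V‖ ≤ 1) {x : ℕ → ℂ} {r : ℝ} (hr : r < 1) (hx : ∀ j, ‖x j‖ ≤ r)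
    {w s : EllTwo (Option (ℕ × α))} (hs0 : s none = 1)
    (hs : ∀ p : ℕ × α, s (some p) = x p.1 * w (some p)) (hw : w = V s) :
    Tendsto (fun N => transferFunction V (truncate x N)) atTop (𝓝 (w none)) := by
  have hr0 : 0 ≤ r := (norm_nonneg _).trans (hx 0)
  have hr2 : 0 < 1 - r ^ 2 := by nlinarith
  have hsq (g : EllTwo (Option (ℕ × α))) : HasSum (fun ω => ‖g ω‖ ^ 2) (‖g‖ ^ 2) := by
    simpa only [ENNReal.toReal_ofNat, Real.rpow_ofNat] using lp.hasSum_norm (by simp) g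
  let t (N : ℕ) (ω : Option (ℕ × α)) : ℝ := ω.elim 0 fun p => if p.1 < N then 0 else ‖s ω‖ ^ 2
  have ht0 (N : ℕ) (ω : Option (ℕ × α)) : 0 ≤ t N ω := by
    cases ω with
    | none => exact le_rfl
    | some p =>
      simp only [t, Option.elim_some]
      split_ifs <;> positivity
  have hts (N : ℕ) (ω : Option (ℕ × α)) : t N ω ≤ ‖s ω‖ ^ 2 := by
    cases ω with
    | none => exact sq_nonneg _
    | some p =>
      simp only [t, Option.elim_some]
      split_ifs
      exacts [sq_nonneg _, le_rfl]
  have htsum (N : ℕ) : Summable (t N) := (hsq s).summable.of_nonneg_of_le (ht0 N) (hts N)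
  have hlim : Tendsto (fun N => ∑' ω, t N ω) atTop (𝓝 0) := by
    have h := tendsto_tsum_of_dominated_convergence (𝓕 := atTop) (f := t) (g := fun _ => (0 : ℝ))
      (bound := fun ω => ‖s ω‖ ^ 2) (hsq s).summable (fun ω => ?_)
      (Eventually.of_forall fun N ω => by
        rw [Real.norm_of_nonneg (ht0 N ω)]
        exact hts N ω)
    · simpa using h
    · cases ω with
      | none => exact tendsto_const_nhds
      | some p =>
        refine tendsto_const_nhds.congr' ?_
        filter_upwards [eventually_gt_atTop p.1] with N hN
        simp only [t, Option.elim_some, if_pos hN]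
  have hbound (N : ℕ) :
      ‖transferFunction V (truncate x N) - w none‖ ≤ √((∑' ω, t N ω) / (1 - r ^ 2)) := by
    have hz : (fun i : Fin N => x i) ∈ polydisk N := fun i => (hx i).trans_lt hr
    obtain ⟨w', s', hs0', hs', hw', hF⟩ := transferFunction_spec (exists_solution_zeroExtend hV hz)
    rw [zeroExtend_restrict] at hF hs'
    -- The two solutions differ by at most `r` times their difference, plus the tail of `s`.
    have hterm (ω : Option (ℕ × α)) : ‖(s - s') ω‖ ^ 2 ≤ r ^ 2 * ‖(w - w') ω‖ ^ 2 + t N ω := by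
      rw [lp.coeFn_sub, lp.coeFn_sub, Pi.sub_apply, Pi.sub_apply]
      cases ω with
      | none =>
        rw [hs0, hs0', sub_self, norm_zero, zero_pow two_ne_zero]
        have := ht0 N none
        positivity
      | some p =>
        simp only [t, Option.elim_some]
        rw [hs', truncate]
        split_ifs with hp
        · rw [hs, ← mul_sub, norm_mul, mul_pow, add_zero]
          gcongr
          exact hx _
        · rw [zero_mul, sub_zero]
          exact le_add_of_nonneg_left (by positivity)
    have h1 := hasSum_le hterm (hsq (s - s')) (((hsq (w - w')).mul_left _).add (htsum N).hasSum)
    have h2 : ‖w - w'‖ ≤ ‖s - s'‖ := by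
      rw [hw, hw', ← map_sub]
      exact (V.le_of_opNorm_le hV _).trans_eq (one_mul _)
    have h3 : ‖w - w'‖ ^ 2 ≤ ‖s - s'‖ ^ 2 := by gcongr
    have h4 : ‖(w - w') none‖ ≤ ‖w - w'‖ := lp.norm_apply_le_norm (by simp) _ _
    rw [lp.coeFn_sub, Pi.sub_apply] at h4
    rw [hF, norm_sub_rev]
    refine h4.trans (Real.le_sqrt_of_sq_le ?_)
    rw [le_div_iff₀ hr2]
    linarith
  refine tendsto_iff_norm_sub_tendsto_zero.2 (squeeze_zero (fun _ => norm_nonneg _) hbound ?_)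
  have h := (Real.continuous_sqrt.tendsto _).comp (hlim.div_const (1 - r ^ 2))
  simpa [Function.comp_def] using h

end FiniteSections

/-! ### The extension of `f` -/

/-- An Agler decomposition says that two finite families of vectors in `ℓ²` have equal Gram
matrices; the transfer function of a contraction that relates them is the extension of `f`. -/
theorem HasAglerDecomposition.hasAglerExtension {X : Set EllInfty} (hfin : X.Finite)
    (hX : X ⊆ Metric.ball (0 : EllInfty) 1) {f : X → ℂ} (h : HasAglerDecomposition X f) :
    HasAglerExtension X f := by
  classical
  have := hfin.fintype
  obtain ⟨K, hK, hM, hs⟩ := h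
  have hnorm (z : X) (j : ℕ) : ‖z.1 j‖ ≤ ‖z.1‖ := lp.norm_apply_le_norm (by simp) _ _
  have hlt (z : X) : ‖z.1‖ < 1 := by simpa using hX z.2
  choose b hb using fun j => (hK j).exists_sum_rankOne
  have hbs (z : X) : Summable fun p : ℕ × X => ‖b p.1 p.2 z‖ ^ 2 := by
    refine (summable_prod_of_nonneg fun _ => by positivity).2
      ⟨fun _ => (hasSum_fintype _).summable, ?_⟩
    refine (Complex.reCLM.summable (hs z)).congr fun j => ?_
    rw [hb, tsum_fintype, map_sum]
    refine Finset.sum_congr rfl fun i _ => ?_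
    rw [Complex.mul_conj, Complex.normSq_eq_norm_sq]
    rfl
  have hmem (z : X) (c : ℂ) (m : ℕ → ℂ) (hm : ∀ j, ‖m j‖ ≤ 1) :
      Memℓp (fun ω : Option (ℕ × X) => ω.elim c fun p => m p.1 * b p.1 p.2 z) 2 := by
    refine memℓp_gen (hasSum_option (Summable.hasSum ?_)).summable
    simp only [ENNReal.toReal_ofNat, Real.rpow_ofNat, Option.elim_some]
    refine (hbs z).of_nonneg_of_le (fun _ => by positivity) fun p => ?_
    rw [norm_mul]
    gcongr
    exact mul_le_of_le_one_left (norm_nonneg _) (hm _)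
  let u (z : X) : EllTwo (Option (ℕ × X)) :=
    ⟨_, hmem z 1 (fun j => z.1 j) fun j => (hnorm z j).trans (hlt z).le⟩
  let v (z : X) : EllTwo (Option (ℕ × X)) := ⟨_, hmem z (f z) (fun _ => 1) (by simp)⟩
  have hsplit (z w : X) (m : ℕ → ℂ) (hm : ∀ j, ‖m j‖ ≤ 1) :
      HasSum (fun p : ℕ × X => m p.1 * (b p.1 p.2 z * conj (b p.1 p.2 w)))
        (∑' j, m j * K j z w) := by
    have hsm : Summable fun p : ℕ × X => m p.1 * (b p.1 p.2 z * conj (b p.1 p.2 w)) := by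
      refine Summable.of_norm_bounded ((hbs z).add (hbs w)) fun p => ?_
      rw [norm_mul, norm_mul, RCLike.norm_conj]
      refine (mul_le_of_le_one_left (by positivity) (hm _)).trans ?_
      nlinarith [sq_nonneg (‖b p.1 p.2 z‖ - ‖b p.1 p.2 w‖), norm_nonneg (b p.1 p.2 z),
        norm_nonneg (b p.1 p.2 w)]
    have h1 := hsm.hasSum.prod_fiberwise fun j => hasSum_fintype _
    have h2 : ∑' j, m j * K j z w =
        ∑' p : ℕ × X, m p.1 * (b p.1 p.2 z * conj (b p.1 p.2 w)) := by
      refine (h1.congr_fun fun j => ?_).tsum_eq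
      rw [hb, Finset.mul_sum]
    rw [h2]
    exact hsm.hasSum
  have hxle (z : X) (j : ℕ) : ‖z.1 j‖ ≤ 1 := (hnorm z j).trans (hlt z).le
  have hxx (z w : X) (j : ℕ) : ‖z.1 j * conj (w.1 j)‖ ≤ 1 := by
    rw [norm_mul, RCLike.norm_conj]
    exact mul_le_one₀ (hxle z j) (norm_nonneg _) (hxle w j)
  have hgram (z w : X) : inner ℂ (u w) (u z) = inner ℂ (v w) (v z) := by
    have hu : inner ℂ (u w) (u z) = 1 + ∑' j, z.1 j * conj (w.1 j) * K j z w := by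
      refine (lp.hasSum_inner (u w) (u z)).unique ?_
      have h1 := hasSum_option (f := fun ω => inner ℂ (u w ω) (u z ω))
        ((hsplit z w (fun j => z.1 j * conj (w.1 j)) (hxx z w)).congr_fun fun p => by
          simp only [u, Option.elim_some, RCLike.inner_apply', map_mul]
          ring)
      have h2 : inner ℂ (u w none) (u z none) = (1 : ℂ) := by simp [u]
      rwa [h2] at h1
    have hv : inner ℂ (v w) (v z) = f z * conj (f w) + ∑' j, 1 * K j z w := by
      refine (lp.hasSum_inner (v w) (v z)).unique ?_
      have h1 := hasSum_option (f := fun ω => inner ℂ (v w ω) (v z ω))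
        ((hsplit z w (fun _ => 1) (by simp)).congr_fun fun p => by
          simp only [v, Option.elim_some, RCLike.inner_apply', map_mul, map_one]
          ring)
      have h2 : inner ℂ (v w none) (v z none) = f z * conj (f w) := by
        simp only [v, Option.elim_none, RCLike.inner_apply', mul_comm]
      rwa [h2] at h1
    have hn := summable_norm_of_diag hK hs z w
    have hsx : Summable fun j => z.1 j * conj (w.1 j) * K j z w :=
      Summable.of_norm_bounded hn fun j => by
        rw [norm_mul]
        exact mul_le_of_le_one_left (norm_nonneg _) (hxx z w j)
    have h1 := (hM z w).tsum_eq
    simp only [sub_mul, one_mul] at h1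
    rw [hn.of_norm.tsum_sub hsx] at h1
    rw [hu, hv]
    simp only [one_mul]
    linear_combination -h1
  obtain ⟨V, hV, hVu⟩ := exists_contraction_of_inner_eq hgram
  refine ⟨transferFunction V, isAglerInfty_transferFunction hV, fun z => ?_⟩
  have h1 := tendsto_transferFunction hV (hlt z) (hnorm z) (w := v z) (s := u z) rfl
    (fun p => by simp [u, v]) (hVu z).symm
  unfold HasExtendedValue
  simp only [zeroExtend_restrict]
  exact h1

end SchurAgler

theorem theorem1p3 (X : Set SchurAgler.EllInfty) (hfin : X.Finite)
    (hX : X ⊆ Metric.ball (0 : SchurAgler.EllInfty) 1)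
    (f : X → ℂ) (hf : ∀ z : X, ‖f z‖ ≤ 1) :
    (SchurAgler.HasAglerExtension X f ↔ SchurAgler.HasAglerDecomposition X f) ∧
    (SchurAgler.HasAglerExtension X f → SchurAgler.SatisfiesMatrixVonNeumann X f) ∧
    (SchurAgler.HasAglerDecomposition X f → SchurAgler.SatisfiesMatrixVonNeumann X f) ∧
    (X ⊆ SchurAgler.hilbertMultidisk →
      (SchurAgler.SatisfiesMatrixVonNeumann X f →
        SchurAgler.HasAglerExtension X f ∧ SchurAgler.HasAglerDecomposition X f)) ∧
    (X ⊆ SchurAgler.hilbertMultidisk →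
      List.TFAE [SchurAgler.HasAglerExtension X f, SchurAgler.HasAglerDecomposition X f,
        SchurAgler.SatisfiesMatrixVonNeumann X f]) := by
  have h12 : SchurAgler.HasAglerExtension X f → SchurAgler.HasAglerDecomposition X f :=
    fun h => h.hasAglerDecomposition hfin hX
  have h21 : SchurAgler.HasAglerDecomposition X f → SchurAgler.HasAglerExtension X f :=
    fun h => h.hasAglerExtension hfin hX
  have h23 : SchurAgler.HasAglerDecomposition X f → SchurAgler.SatisfiesMatrixVonNeumann X f :=
    fun h => h.satisfiesMatrixVonNeumann
  have h32 (hX2 : X ⊆ SchurAgler.hilbertMultidisk) (h : SchurAgler.SatisfiesMatrixVonNeumann X f) :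
      SchurAgler.HasAglerDecomposition X f :=
    SchurAgler.HasAglerDecomposition.of_satisfiesMatrixVonNeumann hfin hX2 h
  refine ⟨⟨h12, h21⟩, fun h => h23 (h12 h), h23, fun hX2 h => ⟨h21 (h32 hX2 h), h32 hX2 h⟩,
    fun hX2 => ?_⟩
  tfae_have 1 ↔ 2 := ⟨h12, h21⟩
  tfae_have 2 → 3 := h23
  tfae_have 3 → 2 := h32 hX2
  tfae_finish
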